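/- **Setting.** Let $X$ be a set, $f:X\to\{0,1\}$ a target and $H=\{h_1,\dots,h_k\}$ a finite nonempty class of functions $h_j:X\to\{0,1\}$ satisfying the Weak Learning Assumption with advantage $\gamma>0$: for every discrete probability distribution $P$ on $X$ there is $h\in H$ with $\Pr_{x\sim P}(h(x)\ne f(x))\le\frac12-\gamma$. Let $S$ be a finite dataset (multiset) of pairs $(x,f(x))$. For a dataset $S'$ let $q(S')$ be its fraction of points with label $1$, let $G(q)=-q\log_2 q-(1-q)\log_2(1-q)$, and put $$J(S',h)=G(q(S'))-\sum_{i\in\{0,1\}}\frac{|S'_{h=i}|}{|S'|}\,G(q(S'_{h=i})).$$ $S_\ell$ denotes the points of $S$ that reach the tree node $\ell$. $\mathrm{Lap}(b)$ is the Laplace distribution with scale $b$; all draws are independent. **Report Noisy Max (RNM)** with privacy parameter $\alpha'$, for scores $f_1,\dots,f_r$ of sensitivity at most $\Delta$, computes $\hat f_i=f_i+Z_i$ with $Z_i\sim\mathrm{Lap}(2\Delta/\alpha')$ and returns $i^*=\arg\max_i\hat f_i$ and $\hat f_{i^*}$. $\mathrm{PrivateSplit}(\ell,\alpha')$ is RNM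 applied to the scores $f_j=J(S_\ell,h_j)$, with $\Delta=\Delta_m$ for $m=|S_\ell|$; it returns a split $\hat h\in H$ and an estimate $\hat J$ of its gain. Here $\Delta_m$ is either the exact sensitivity, i.e. the maximum of $|J(S_1,h)-J(S_2,h)|$ over $h\in H$ and all labelled datasets $S_1,S_2$ of size $m$ differing in at most one point, or its closed-form bound $10\log_2(m)/m$. **DP-TopDown** with uniform budgeting $\mathcal B(d)=1/M$, on input $S$, $M\ge1$, $\varepsilon,\delta\in(0,1]$, $\alpha>0$: start with a single leaf $\ell$, run PrivateSplit on it with privacy parameter $\frac{\alpha}{2M}$, and put $(\ell,\hat h)$ into a priority queue with priority $\hat J$. In each of $M$ iterations pop the entry $(\ell^*,h^*)$ of highest priority (if the queue is empty, do nothing) and split $\ell^*$ by $h^*$ into two leaves. For each new leaf $\ell_i$, with $\alpha_\ell=\frac{\alpha}{2M}$, compute $w_i=\frac{|S_{\ell_i}|}{|S|}+\mathrm{Lap}\!\left(\frac{2}{|S|\alpha_\ell}\right)$ and $(\hat h_i,\hat J_i)=\mathrm{PrivateSplit}(\ell_i,\frac{\alpha_\ell}{2})$, and put $(\ell_i,\hat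 h_i)$ into the queue with priority $w_i\hat J_i$ if $w_i\ge\frac{\varepsilon}{M}$. Finally label each leaf by RNM with privacy parameter $\frac{\alpha}{2}$ on its two label counts (sensitivity $1$). For $t\le M$ let $T_t$ be the tree after $t$ iterations, with leaves labelled in this way; $T_M$ is the output. **Corollary.** There are universal constants $C>0$ and $p\in\mathbb N$ such that, in this setting, whenever $$|S|\;\ge\; C\,\frac{M^3}{\varepsilon^2\gamma^2\alpha}\,\Bigl(\ln\Bigl(\frac{e\,k\,M}{\varepsilon\,\delta\,\gamma}\bigl(1+\tfrac1\alpha\bigr)\Bigr)\Bigr)^{p},$$ i.e. $|S|\ge\widetilde O\bigl(\frac{M^3}{\varepsilon^2\gamma^2\alpha}\bigr)$, the following holds with probability at least $1-\delta$: for every $t\le M$ with $t\ge(1/\varepsilon)^{C\ln(1/\varepsilon)/\gamma^2}$, the tree $T_t$ has training error (fraction of misclassified points of $S$) at most $\varepsilon$. Thus $(1/\varepsilon)^{O(\log(1/\varepsilon)/\gamma^2)}$ splits suffice for training error at most $\varepsilon$; in particular, if $M$ is at least this number, the output of DP-TopDown has training error at most $\varepsilon$ with probability at least $1-\delta$. 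-/

import Mathlib

open MeasureTheory

noncomputable section

/-- The Laplace distribution with scale `b > 0`: density `exp (-|x| / b) / (2 b)`. -/
def laplace (b : ℝ) : Measure ℝ :=
  volume.withDensity fun x => ENNReal.ofReal (Real.exp (-|x| / b) / (2 * b))

instance laplace_isProbabilityMeasure : IsProbabilityMeasure (laplace 1) := by
  have hs : ∫ x : ℝ, Real.exp (-|x|) = 2 := by
    rw [integral_comp_abs (f := fun x => Real.exp (-x)), integral_exp_neg_Ioi_zero]
    norm_num
  have hi : Integrable fun x : ℝ => Real.exp (-|x|) := by
    by_contra hc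
    rw [integral_undef hc] at hs
    norm_num at hs
  constructor
  rw [laplace, withDensity_apply _ MeasurableSet.univ, Measure.restrict_univ,
    ← ofReal_integral_eq_lintegral_ofReal]
  · simp only [div_one, mul_one, integral_div, hs]
    norm_num
  · simpa using hi.div_const 2
  · exact Filter.Eventually.of_forall fun x => by positivity

/-- Scaling a `Lap(1)` variable by `b > 0` gives a `Lap(b)` variable. -/
theorem laplace_map_mul (b : ℝ) (hb : 0 < b) :
    (laplace 1).map (fun z => b * z) = laplace b := by
  have hm : Measurable fun z : ℝ => b * z := measurable_const_mul b
  have hg : Measurable fun y : ℝ => ENNReal.ofReal (Real.exp (-|y| / b) / 2) := by fun_prop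
  have hd : Measurable fun y : ℝ => ENNReal.ofReal (Real.exp (-|y| / b) / (2 * b)) := by fun_prop
  ext s hs
  rw [Measure.map_apply hm hs, laplace, laplace, withDensity_apply _ (hm hs),
    withDensity_apply _ hs]
  have h1 : ∀ x : ℝ, ENNReal.ofReal (Real.exp (-|x| / 1) / (2 * 1))
      = ENNReal.ofReal (Real.exp (-|b * x| / b) / 2) := by
    intro x
    rw [abs_mul, abs_of_pos hb]
    congr 3
    · field_simp
    · norm_num
  simp_rw [h1]
  rw [← setLIntegral_map hs hg hm, Real.map_volume_mul_left hb.ne', Measure.restrict_smul,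
    lintegral_smul_measure, smul_eq_mul, ← lintegral_const_mul _ hg]
  congr 1
  ext y
  rw [← ENNReal.ofReal_mul (abs_nonneg _), abs_of_pos (inv_pos.mpr hb)]
  congr 1
  field_simp

/-- A labelled dataset: a finite multiset of pairs (example, binary label). -/
abbrev Dataset (X : Type*) := Multiset (X × Bool)

/-- Two datasets are neighbouring when they differ in (at most) one point. -/
def Neighbouring {X : Type*} (S S' : Dataset X) : Prop :=
  ∃ (R : Dataset X) (a b : X × Bool), S = a ::ₘ R ∧ S' = b ::ₘ R

/-- The entropy splitting criterion (base two, so that its value at `1/2` is `1`). -/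
def splitEntropy (q : ℝ) : ℝ := -q * Real.logb 2 q - (1 - q) * Real.logb 2 (1 - q)

/-- The fraction of points of `S` with label `1` (read as `0` if `S` is empty). -/
def posFraction {X : Type*} (S : Dataset X) : ℝ :=
  (S.countP fun z => z.2 = true : ℝ) / (S.card : ℝ)

/-- The part of `S` that the splitting function `h` sends to child `i`. -/
def child {X : Type*} (S : Dataset X) (h : X → Bool) (i : Bool) : Dataset X :=
  S.filter fun z => h z.1 = i

/-- `J(S, h)`: the decrease of the splitting criterion when `S` is split by `h`. -/
def splitGain {X : Type*} (S : Dataset X) (h : X → Bool) : ℝ :=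
  splitEntropy (posFraction S)
    - ((child S h false).card : ℝ) / (S.card : ℝ) * splitEntropy (posFraction (child S h false))
    - ((child S h true).card : ℝ) / (S.card : ℝ) * splitEntropy (posFraction (child S h true))

/-- The largest sensitivity of `S ↦ J(S, h j)` over the class, on datasets of size `m`. -/
def gainSensitivity {X : Type*} {k : ℕ} (h : Fin k → X → Bool) (m : ℕ) : ℝ :=
  sSup {r | ∃ (j : Fin k) (S S' : Dataset X), S.card = m ∧ Neighbouring S S' ∧
    r = |splitGain S (h j) - splitGain S' (h j)|}

/-- The closed-form upper bound `10 lg(m) / m` on that sensitivity. -/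
def gainSensitivityBound (m : ℕ) : ℝ := 10 * Real.logb 2 m / m

/-- The class `{h j}` satisfies the Weak Learning Assumption for the target `f` with
advantage `γ`. -/
def WeakLearning {X : Type*} {k : ℕ} (h : Fin k → X → Bool) (f : X → Bool) (γ : ℝ) : Prop :=
  ∀ P : PMF X, ∃ j, (P.toOuterMeasure {x | h j x ≠ f x}).toReal ≤ 1 / 2 - γ

/-- The first index at which `g` attains its maximum. -/
def argmaxFin {k : ℕ} [NeZero k] (g : Fin k → ℝ) : Fin k :=
  ((List.finRange k).argmax g).getD 0

/-- Report Noisy Max with privacy parameter `α` for scores of sensitivity `Δ`. The entries of `Z`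
are independent `Lap(1)` draws, so that the added noise is `Lap(2 Δ / α)`. -/
def reportNoisyMax {k : ℕ} [NeZero k] (score : Fin k → ℝ) (Δ α : ℝ) (Z : Fin k → ℝ) :
    Fin k × ℝ :=
  let noisy : Fin k → ℝ := fun i => score i + 2 * Δ / α * Z i
  (argmaxFin noisy, noisy (argmaxFin noisy))

/-- A private splitting routine: from the data at a leaf, a privacy parameter, a failure
probability and its random draws, it returns (the index of) a split and an estimate of its gain. -/
abbrev SplitRoutine (X : Type*) (k : ℕ) :=
  Dataset X → ℝ → ℝ → (Fin k → ℝ) → Fin k × ℝ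

/-- Single-machine Report Noisy Max as a splitting routine; `Δ m` is the sensitivity value used
for a leaf with `m` data points. It does not use the failure probability. -/
def rnmSplit {X : Type*} {k : ℕ} [NeZero k] (h : Fin k → X → Bool) (Δ : ℕ → ℝ) :
    SplitRoutine X k :=
  fun S α _ Z => reportNoisyMax (fun j => splitGain S (h j)) (Δ S.card) α Z

/-- Binary decision trees; each leaf carries an identifier. -/
inductive DecTree (X : Type*) where
  | leaf (id : ℕ) : DecTree X
  | node (h : X → Bool) (left right : DecTree X) : DecTree X

/-- The leaf which the example `x` reaches. -/
def DecTree.route {X : Type*} : DecTree X → X → ℕ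
  | .leaf id, _ => id
  | .node h l r, x => if h x then r.route x else l.route x

/-- Replace the leaf `ℓ` by an internal node that splits by `h`, with new leaves `c₀`, `c₁`. -/
def DecTree.splitLeaf {X : Type*} (ℓ : ℕ) (h : X → Bool) (c₀ c₁ : ℕ) : DecTree X → DecTree X
  | .leaf id => if id = ℓ then .node h (.leaf c₀) (.leaf c₁) else .leaf id
  | .node g l r => .node g (l.splitLeaf ℓ h c₀ c₁) (r.splitLeaf ℓ h c₀ c₁)

/-- The data that reaches the leaf `ℓ`. -/
def DecTree.leafData {X : Type*} (T : DecTree X) (S : Dataset X) (ℓ : ℕ) : Dataset X :=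
  S.filter fun z => T.route z.1 = ℓ

/-- The kinds of random draws attached to a tree node: one per candidate split, one for the weight
estimate, one for each of the two labels. -/
inductive Draw (k : ℕ) where
  | split (j : Fin k) : Draw k
  | weight : Draw k
  | label (y : Fin 2) : Draw k

/-- The random tape: `ω (c, d)` is the draw of kind `d` for the tree node with identifier `c`. -/
abbrev Tape (k : ℕ) := ℕ × Draw k → ℝ

/-- All entries of the tape are independent `Lap(1)` variables. -/
def tapeLaw (k : ℕ) : Measure (Tape k) := Measure.infinitePi fun _ => laplace 1

/-- A queue entry: a leaf, its depth (the root has depth `1`), its split, and its priority. -/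
structure QueueEntry (k : ℕ) where
  leaf : ℕ
  depth : ℕ
  split : Fin k
  priority : ℝ

/-- The current tree and the priority queue. -/
structure TopDownState (X : Type*) (k : ℕ) where
  tree : DecTree X
  queue : List (QueueEntry k)

section Algorithm

variable {X : Type*} {k : ℕ} (split : SplitRoutine X k) (B : ℕ → ℝ) (h : Fin k → X → Bool)
  (S : Dataset X) (M : ℕ) (ε α δ : ℝ) (ω : Tape k)

/-- The start of DP-TopDown: a single leaf (with identifier `0`), pushed with priority `Ĵ`. -/
def topDownInit : TopDownState X k :=
  let r := split S (α / 2 * B 1) (δ / (2 * (2 * M + 1))) fun j => ω (0, .split j)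
  { tree := .leaf 0, queue := [⟨0, 1, r.1, r.2⟩] }

/-- What is pushed for the new leaf `c` of depth `d` of the tree `T`: the entry with priority
`w * Ĵ` if the estimated weight `w` is at least `ε / M`, and nothing otherwise. -/
def topDownPush (T : DecTree X) (c d : ℕ) : List (QueueEntry k) :=
  let αl := α / 2 * B d
  let w := ((T.leafData S c).card : ℝ) / (S.card : ℝ) + 2 / (S.card * αl) * ω (c, .weight)
  let r := split (T.leafData S c) (αl / 2) (δ / (2 * (2 * M + 1))) fun j => ω (c, .split j)
  if ε / M ≤ w then [⟨c, d, r.1, w * r.2⟩] else []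

/-- One iteration: pop the entry of highest priority, split its leaf, and treat the two new leaves,
whose identifiers are `2 t + 1` and `2 t + 2` in iteration number `t = 0, 1, …`. Nothing happens
if the queue is empty. -/
def topDownStep (t : ℕ) (s : TopDownState X k) : TopDownState X k :=
  match s.queue.argmax QueueEntry.priority with
  | none => s
  | some e =>
    let T := s.tree.splitLeaf e.leaf (h e.split) (2 * t + 1) (2 * t + 2)
    { tree := T
      queue := s.queue.filter (fun e' => e'.leaf ≠ e.leaf)
        ++ topDownPush split B S M ε α δ ω T (2 * t + 1) (e.depth + 1)
        ++ topDownPush split B S M ε α δ ω T (2 * t + 2) (e.depth + 1) }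

/-- The state after `t` iterations. -/
def topDownRun : ℕ → TopDownState X k
  | 0 => topDownInit split B S M α δ ω
  | t + 1 => topDownStep split B h S M ε α δ ω t (topDownRun t)

/-- The label given to the leaf `ℓ` of `T`: Report Noisy Max with budget `α / 2` on the two label
counts (of sensitivity `1`) at that leaf. -/
def noisyLabel (T : DecTree X) (ℓ : ℕ) : Bool :=
  finTwoEquiv (reportNoisyMax
    (fun y : Fin 2 => (((T.leafData S ℓ).countP fun z => z.2 = finTwoEquiv y : ℕ) : ℝ))
    1 (α / 2) (fun y => ω (ℓ, .label y))).1

/-- The classifier given by the tree after `t` iterations, its leaves labelled privately.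
For `t = M` it is the output of DP-TopDown. -/
def topDownClassifier (t : ℕ) (x : X) : Bool :=
  let T := (topDownRun split B h S M ε α δ ω t).tree
  noisyLabel S α ω T (T.route x)

end Algorithm

/-- The fraction of the points of `S` that the classifier `g` gets wrong. -/
def trainingError {X : Type*} (S : Dataset X) (g : X → Bool) : ℝ :=
  (S.countP fun z => g z.1 ≠ z.2 : ℝ) / (S.card : ℝ)

end

/-- A tail bound for the Laplace distribution. -/
theorem laplace_one_tail_le (t : ℝ) :
    laplace 1 {x | t < |x|} ≤ ENNReal.ofReal (2 * Real.exp (-t / 2)) := by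
  have hs : MeasurableSet {x : ℝ | t < |x|} := measurableSet_lt measurable_const measurable_id.abs
  have h2 : laplace 2 Set.univ = 1 := by
    rw [← laplace_map_mul 2 two_pos, Measure.map_apply (measurable_const_mul 2) MeasurableSet.univ]
    simp
  have hd : Measurable fun x : ℝ => ENNReal.ofReal (Real.exp (-|x| / 2) / (2 * 2)) := by fun_prop
  rw [laplace, withDensity_apply _ hs]
  calc ∫⁻ x in {x : ℝ | t < |x|}, ENNReal.ofReal (Real.exp (-|x| / 1) / (2 * 1))
      ≤ ∫⁻ x in {x : ℝ | t < |x|}, ENNReal.ofReal (2 * Real.exp (-t / 2)) *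
          ENNReal.ofReal (Real.exp (-|x| / 2) / (2 * 2)) := by
        refine setLIntegral_mono' hs fun x hx => ?_
        rw [← ENNReal.ofReal_mul (by positivity)]
        refine ENNReal.ofReal_le_ofReal ?_
        have h1 : Real.exp (-|x| / 1) ≤ Real.exp (-t / 2) * Real.exp (-|x| / 2) := by
          rw [← Real.exp_add]
          have hx' : t < |x| := hx
          exact Real.exp_le_exp.mpr (by linarith)
        linarith
    _ ≤ ∫⁻ x, ENNReal.ofReal (2 * Real.exp (-t / 2)) *
          ENNReal.ofReal (Real.exp (-|x| / 2) / (2 * 2)) := setLIntegral_le_lintegral _ _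
    _ = ENNReal.ofReal (2 * Real.exp (-t / 2)) := by
        rw [lintegral_const_mul _ hd]
        rw [laplace, withDensity_apply _ MeasurableSet.univ, Measure.restrict_univ] at h2
        rw [h2, mul_one]

/-- The draws attached to a node, as a sum type. -/
def drawEquiv (k : ℕ) : Draw k ≃ Fin k ⊕ (Unit ⊕ Fin 2) where
  toFun d := match d with
    | .split j => .inl j
    | .weight => .inr (.inl ())
    | .label y => .inr (.inr y)
  invFun s := match s with
    | .inl j => .split j
    | .inr (.inl _) => .weight
    | .inr (.inr y) => .label y
  left_inv d := by cases d <;> rfl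
  right_inv s := by rcases s with j | u | y <;> rfl

instance (k : ℕ) : Fintype (Draw k) := Fintype.ofEquiv _ (drawEquiv k).symm

theorem card_draw (k : ℕ) : Fintype.card (Draw k) = k + 3 := by
  rw [Fintype.card_congr (drawEquiv k)]
  simp

instance (k : ℕ) : IsProbabilityMeasure (tapeLaw k) := by
  unfold tapeLaw
  infer_instance

/-- With high probability all the draws for the first `m` nodes are small. -/
theorem tapeLaw_exists_large_le (k m : ℕ) (t : ℝ) :
    tapeLaw k {ω | ∃ c < m, ∃ d, t < |ω (c, d)|}
      ≤ ENNReal.ofReal (m * (k + 3) * (2 * Real.exp (-t / 2))) := by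
  have hs : MeasurableSet {x : ℝ | t < |x|} := measurableSet_lt measurable_const measurable_id.abs
  have hsub : {ω : Tape k | ∃ c < m, ∃ d, t < |ω (c, d)|}
      ⊆ ⋃ i ∈ (Finset.range m ×ˢ (Finset.univ : Finset (Draw k))), {ω : Tape k | t < |ω i|} := by
    rintro ω ⟨c, hc, d, hd⟩
    simp only [Set.mem_iUnion]
    exact ⟨(c, d), by simpa using hc, hd⟩
  refine (measure_mono hsub).trans ((measure_biUnion_finset_le _ _).trans ?_)
  have hi : ∀ i : ℕ × Draw k, tapeLaw k {ω : Tape k | t < |ω i|}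
      ≤ ENNReal.ofReal (2 * Real.exp (-t / 2)) := by
    intro i
    have h1 := (measurePreserving_eval_infinitePi (fun _ : ℕ × Draw k => laplace 1) i).measure_preimage
      hs.nullMeasurableSet
    exact h1.le.trans (laplace_one_tail_le t)
  refine (Finset.sum_le_card_nsmul _ _ _ fun i _ => hi i).trans ?_
  have hc : ((m * (k + 3) : ℕ) : ENNReal) = ENNReal.ofReal (m * (k + 3)) := by
    rw [← ENNReal.ofReal_natCast]
    push_cast
    rfl
  rw [Finset.card_product, Finset.card_range, Finset.card_univ, card_draw, nsmul_eq_mul,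
    ENNReal.ofReal_mul (p := m * (k + 3)) (by positivity), hc]

/-- The entropy of the label distribution of a set with `a` positive and `b` negative points, times
the number of its points (in nats). -/
noncomputable def labelEntropy (a b : ℝ) : ℝ :=
  (a + b) * Real.log (a + b) - a * Real.log a - b * Real.log b

theorem mul_log_sub_mul_log_le {x y : ℝ} (hx : 0 ≤ x) (hy : 0 < y) :
    x * Real.log y - x * Real.log x ≤ y - x := by
  rcases hx.eq_or_lt with rfl | hx
  · simpa using hy.le
  · have h1 := Real.log_le_sub_one_of_pos (div_pos hy hx)
    rw [Real.log_div hy.ne' hx.ne'] at h1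
    have h2 := mul_le_mul_of_nonneg_left h1 hx.le
    have h3 : x * (y / x - 1) = y - x := by field_simp
    linarith

theorem labelEntropy_le_cross {a b p : ℝ} (ha : 0 ≤ a) (hb : 0 ≤ b) (hp : 0 < p) (hp1 : p < 1) :
    labelEntropy a b ≤ -(a * Real.log p) - b * Real.log (1 - p) := by
  rcases (add_nonneg ha hb).eq_or_lt with h | h
  · have h1 : a = 0 := by linarith
    have h2 : b = 0 := by linarith
    simp [labelEntropy, h1, h2]
  · have h1 := mul_log_sub_mul_log_le ha (mul_pos hp h)
    have h2 := mul_log_sub_mul_log_le hb (mul_pos (sub_pos.mpr hp1) h)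
    rw [Real.log_mul hp.ne' h.ne'] at h1
    rw [Real.log_mul (sub_pos.mpr hp1).ne' h.ne'] at h2
    unfold labelEntropy
    nlinarith

theorem labelEntropy_comm (a b : ℝ) : labelEntropy a b = labelEntropy b a := by
  unfold labelEntropy
  rw [add_comm a b]
  ring

theorem labelEntropy_le_log_two {a b : ℝ} (ha : 0 ≤ a) (hb : 0 ≤ b) :
    labelEntropy a b ≤ (a + b) * Real.log 2 := by
  have h := labelEntropy_le_cross ha hb (p := 1 / 2) (by norm_num) (by norm_num)
  have h1 : Real.log (1 / 2) = -Real.log 2 := by rw [one_div, Real.log_inv]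
  have h2 : (1 - 1 / 2 : ℝ) = 1 / 2 := by norm_num
  rw [h2, h1] at h
  linarith

theorem min_mul_log_two_le_labelEntropy {a b : ℝ} (ha : 0 ≤ a) (hb : 0 ≤ b) :
    min a b * Real.log 2 ≤ labelEntropy a b := by
  wlog hab : a ≤ b generalizing a b
  · rw [labelEntropy_comm, min_comm]
    exact this hb ha (le_of_not_ge hab)
  rw [min_eq_left hab]
  rcases ha.eq_or_lt with rfl | ha
  · simp [labelEntropy]
  · have hb' : 0 < b := ha.trans_le hab
    have h1 : Real.log 2 + Real.log a ≤ Real.log (a + b) := by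
      rw [← Real.log_mul two_ne_zero ha.ne']
      exact Real.log_le_log (by positivity) (by linarith)
    have h2 : Real.log b ≤ Real.log (a + b) := Real.log_le_log hb' (by linarith)
    unfold labelEntropy
    nlinarith

theorem labelEntropy_nonneg {a b : ℝ} (ha : 0 ≤ a) (hb : 0 ≤ b) : 0 ≤ labelEntropy a b :=
  (mul_nonneg (le_min ha hb) (Real.log_nonneg one_le_two)).trans
    (min_mul_log_two_le_labelEntropy ha hb)

theorem sub_add_sq_div_le_mul_log_sub {x y : ℝ} (hx : 0 ≤ x) (hy : 0 < y) :
    x - y + (x - y) ^ 2 / (2 * (x + y)) ≤ x * Real.log x - x * Real.log y := by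
  obtain ⟨s, hs, rfl⟩ : ∃ s, 0 ≤ s ∧ x = s ^ 2 := ⟨√x, Real.sqrt_nonneg x, (Real.sq_sqrt hx).symm⟩
  obtain ⟨t, ht, rfl⟩ : ∃ t, 0 < t ∧ y = t ^ 2 :=
    ⟨√y, Real.sqrt_pos.mpr hy, (Real.sq_sqrt hy.le).symm⟩
  have h1 : (s ^ 2 - t ^ 2) ^ 2 / (2 * (s ^ 2 + t ^ 2)) ≤ (s - t) ^ 2 := by
    rw [div_le_iff₀ (by positivity)]
    nlinarith [mul_nonneg (sq_nonneg (s - t)) (sq_nonneg (s - t))]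
  have h2 : s * Real.log t - s * Real.log s ≤ t - s := mul_log_sub_mul_log_le hs ht
  have h3 := mul_le_mul_of_nonneg_left h2 hs
  rw [Real.log_pow, Real.log_pow]
  push_cast
  nlinarith

theorem sq_div_mul_le_sq_div {u v γ D : ℝ} (hu : 0 < u) (huv : u ≤ v)
    (hD : (2 * γ * (u * v)) ^ 2 ≤ D ^ 2) :
    γ ^ 2 / 2 * u ≤ (D / (u + v)) ^ 2 / (2 * u) := by
  have hn : 0 < u + v := by linarith
  rw [le_div_iff₀ (by positivity), div_pow, le_div_iff₀ (by positivity)]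
  refine le_trans ?_ hD
  have h1 : (u + v) ^ 2 ≤ (2 * v) ^ 2 := pow_le_pow_left₀ hn.le (by linarith) 2
  calc γ ^ 2 / 2 * u * (2 * u) * (u + v) ^ 2 = (γ * u) ^ 2 * (u + v) ^ 2 := by ring
    _ ≤ (γ * u) ^ 2 * (2 * v) ^ 2 := mul_le_mul_of_nonneg_left h1 (sq_nonneg _)
    _ = (2 * γ * (u * v)) ^ 2 := by ring

/-- A split that separates the labels with advantage `γ` decreases the label entropy. -/
theorem labelEntropy_gain {a b c d γ : ℝ} (ha : 0 ≤ a) (hb : 0 ≤ b) (hc : 0 ≤ c) (hd : 0 ≤ d)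
    (hp : 0 < a + c) (hq : 0 < b + d) (hγ : 0 < γ)
    (hsep : 2 * γ * ((a + c) * (b + d)) ≤ a * (b + d) - b * (a + c)) :
    γ ^ 2 / 2 * min (a + c) (b + d)
      ≤ labelEntropy (a + c) (b + d) - labelEntropy a b - labelEntropy c d := by
  set p := a + c with hpdef
  set q := b + d with hqdef
  have hpq : 0 < p * q := mul_pos hp hq
  have hD : 0 < a * d - b * c := by
    have : a * q - b * p = a * d - b * c := by rw [hpdef, hqdef]; ring
    nlinarith
  have hab : 0 < a + b := by
    rcases ha.eq_or_lt with h | h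
    · subst h; nlinarith
    · linarith
  have hcd : 0 < c + d := by
    rcases hd.eq_or_lt with h | h
    · subst h; nlinarith
    · linarith
  have hn : 0 < p + q := by linarith
  set n := p + q with hndef
  set D := a * d - b * c with hDdef
  have hpinsk : ∀ x r s : ℝ, 0 ≤ x → 0 < r → 0 < s →
      x - r * s / n + (x - r * s / n) ^ 2 / (2 * (x + r * s / n))
        ≤ x * Real.log x - x * (Real.log r + Real.log s - Real.log n) := by
    intro x r s hx hr hs
    have h := sub_add_sq_div_le_mul_log_sub hx (y := r * s / n) (by positivity)
    rwa [Real.log_div (by positivity) hn.ne', Real.log_mul hr.ne' hs.ne'] at h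
  have h1 := hpinsk a (a + b) p ha hab hp
  have h2 := hpinsk b (a + b) q hb hab hq
  have h3 := hpinsk c (c + d) p hc hcd hp
  have h4 := hpinsk d (c + d) q hd hcd hq
  have e1 : a - (a + b) * p / n = D / n := by
    rw [eq_div_iff hn.ne', sub_mul, div_mul_cancel₀ _ hn.ne', hDdef, hndef, hpdef, hqdef]; ring
  have e2 : b - (a + b) * q / n = -(D / n) := by
    rw [← neg_div, eq_div_iff hn.ne', sub_mul, div_mul_cancel₀ _ hn.ne', hDdef, hndef, hpdef, hqdef]
    ring
  have e3 : c - (c + d) * p / n = -(D / n) := by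
    rw [← neg_div, eq_div_iff hn.ne', sub_mul, div_mul_cancel₀ _ hn.ne', hDdef, hndef, hpdef, hqdef]
    ring
  have e4 : d - (c + d) * q / n = D / n := by
    rw [eq_div_iff hn.ne', sub_mul, div_mul_cancel₀ _ hn.ne', hDdef, hndef, hpdef, hqdef]; ring
  have hbound : ∀ x r s : ℝ, 0 ≤ x → x ≤ s → 0 < r → r ≤ n → 0 < s →
      (D / n) ^ 2 / (4 * s) ≤ (D / n) ^ 2 / (2 * (x + r * s / n)) := by
    intro x r s hx hxs hr hrn hs
    have : r * s / n ≤ s := by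
      rw [div_le_iff₀ hn]; nlinarith
    have h0 : 0 < r * s / n := by positivity
    exact div_le_div_of_nonneg_left (sq_nonneg _) (by linarith) (by linarith)
  have hrow1 : a + b ≤ n := by linarith
  have hrow2 : c + d ≤ n := by linarith
  have b1 := hbound a (a + b) p ha (by linarith) hab hrow1 hp
  have b2 := hbound b (a + b) q hb (by linarith) hab hrow1 hq
  have b3 := hbound c (c + d) p hc (by linarith) hcd hrow2 hp
  have b4 := hbound d (c + d) q hd (by linarith) hcd hrow2 hq
  rw [e1] at h1
  rw [e2, neg_sq] at h2
  rw [e3, neg_sq] at h3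
  rw [e4] at h4
  have hgain : (D / n) ^ 2 / (2 * p) + (D / n) ^ 2 / (2 * q)
      ≤ labelEntropy p q - labelEntropy a b - labelEntropy c d := by
    have hsum : labelEntropy p q - labelEntropy a b - labelEntropy c d
        = (a * Real.log a - a * (Real.log (a + b) + Real.log p - Real.log n))
        + (b * Real.log b - b * (Real.log (a + b) + Real.log q - Real.log n))
        + (c * Real.log c - c * (Real.log (c + d) + Real.log p - Real.log n))
        + (d * Real.log d - d * (Real.log (c + d) + Real.log q - Real.log n)) := by
      unfold labelEntropy
      rw [← hndef]
      have : n = a + b + c + d := by rw [hndef, hpdef, hqdef]; ring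
      have hl : n * Real.log n = (a + b + c + d) * Real.log n := by rw [← this]
      have hlp : p * Real.log p = (a + c) * Real.log p := by rw [hpdef]
      have hlq : q * Real.log q = (b + d) * Real.log q := by rw [hqdef]
      rw [hl, hlp, hlq]
      ring
    have ep : (D / n) ^ 2 / (2 * p) = (D / n) ^ 2 / (4 * p) + (D / n) ^ 2 / (4 * p) := by
      field_simp; ring
    have eq' : (D / n) ^ 2 / (2 * q) = (D / n) ^ 2 / (4 * q) + (D / n) ^ 2 / (4 * q) := by
      field_simp; ring
    rw [hsum, ep, eq']
    linarith
  have hDpq : 2 * γ * (p * q) ≤ D := by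
    have : a * q - b * p = D := by rw [hDdef, hpdef, hqdef]; ring
    linarith
  have hDsq : (2 * γ * (p * q)) ^ 2 ≤ D ^ 2 := pow_le_pow_left₀ (by positivity) hDpq 2
  have hp2 : 0 ≤ (D / n) ^ 2 / (2 * p) := by positivity
  have hq2 : 0 ≤ (D / n) ^ 2 / (2 * q) := by positivity
  rcases le_total p q with h | h
  · rw [min_eq_left h]
    have := sq_div_mul_le_sq_div hp h hDsq
    linarith
  · rw [min_eq_right h]
    rw [mul_comm p q] at hDsq
    have := sq_div_mul_le_sq_div hq h hDsq
    rw [add_comm q p, ← hndef] at this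
    linarith

theorem abs_mul_log_sub_le {x y m : ℕ} (hx : x ≤ m) (hy : y ≤ m) (h1 : x ≤ y + 1)
    (h2 : y ≤ x + 1) :
    |(x : ℝ) * Real.log x - y * Real.log y| ≤ 1 + Real.log m := by
  wlog hxy : y ≤ x generalizing x y
  · rw [abs_sub_comm]
    exact this hy hx h2 h1 (by omega)
  rcases hxy.eq_or_lt with rfl | hlt
  · have := Real.log_natCast_nonneg m
    simp only [sub_self, abs_zero]
    linarith
  obtain rfl : x = y + 1 := by omega
  have hlog : Real.log ((y + 1 : ℕ) : ℝ) ≤ Real.log m :=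
    Real.log_le_log (by positivity) (by exact_mod_cast hx)
  have h0 := Real.log_natCast_nonneg (y + 1)
  push_cast at hlog h0 ⊢
  have h3 := mul_log_sub_mul_log_le (x := (y : ℝ)) (y := (y : ℝ) + 1) (by positivity) (by positivity)
  have h4 : (y : ℝ) * Real.log y ≤ y * Real.log (y + 1) := by
    rcases Nat.eq_zero_or_pos y with rfl | hy0
    · simp
    · exact mul_le_mul_of_nonneg_left (Real.log_le_log (by exact_mod_cast hy0) (by linarith))
        (by positivity)
  rw [abs_le]
  constructor <;> nlinarith

section Datasets

variable {X : Type*}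

/-- The number of points of `S` with label `y`. -/
def labelCount (y : Bool) (S : Dataset X) : ℕ := S.countP fun z => z.2 = y

/-- The label entropy of a dataset. -/
noncomputable def dataEntropy (S : Dataset X) : ℝ :=
  labelEntropy (labelCount true S) (labelCount false S)

theorem labelCount_add (S : Dataset X) : labelCount true S + labelCount false S = S.card := by
  unfold labelCount
  induction S using Multiset.induction_on with
  | empty => simp
  | cons z S ih =>
    rcases z with ⟨x, y⟩
    cases y <;> simp <;> omega

theorem labelCount_child_add (y : Bool) (S : Dataset X) (g : X → Bool) :
    labelCount y (child S g true) + labelCount y (child S g false) = labelCount y S := by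
  unfold labelCount child
  induction S using Multiset.induction_on with
  | empty => simp
  | cons z S ih =>
    rcases z with ⟨x, y'⟩
    simp only [Multiset.countP_filter] at ih ⊢
    cases hg : g x <;> by_cases hy : y' = y <;> simp [hg, hy] <;> omega

theorem add_mul_splitEntropy {a b : ℝ} (ha : 0 ≤ a) (hb : 0 ≤ b) :
    (a + b) * splitEntropy (a / (a + b)) * Real.log 2 = labelEntropy a b := by
  have hl : Real.log 2 ≠ 0 := (Real.log_pos one_lt_two).ne'
  rcases (add_nonneg ha hb).eq_or_lt with h | hn
  · have h1 : a = 0 := by linarith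
    have h2 : b = 0 := by linarith
    simp [labelEntropy, h1, h2]
  · have e1 : 1 - a / (a + b) = b / (a + b) := by field_simp; ring
    have key : ∀ x : ℝ, 0 ≤ x → (a + b) * (x / (a + b) * Real.logb 2 (x / (a + b))) * Real.log 2
        = x * Real.log x - x * Real.log (a + b) := by
      intro x hx
      rcases hx.eq_or_lt with h | hx
      · simp [← h]
      · rw [Real.logb, Real.log_div hx.ne' hn.ne']
        field_simp
    rw [splitEntropy, e1]
    have : (a + b) * (-(a / (a + b)) * Real.logb 2 (a / (a + b))
          - b / (a + b) * Real.logb 2 (b / (a + b))) * Real.log 2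
        = -((a + b) * (a / (a + b) * Real.logb 2 (a / (a + b))) * Real.log 2)
          - (a + b) * (b / (a + b) * Real.logb 2 (b / (a + b))) * Real.log 2 := by ring
    rw [this, key a ha, key b hb, labelEntropy]
    ring

theorem card_mul_splitEntropy (S : Dataset X) :
    (S.card : ℝ) * splitEntropy (posFraction S) * Real.log 2 = dataEntropy S := by
  have hc : (labelCount true S : ℝ) + labelCount false S = S.card := by
    exact_mod_cast labelCount_add S
  have hp : posFraction S = labelCount true S / S.card := rfl
  rw [hp, ← hc]
  exact add_mul_splitEntropy (Nat.cast_nonneg _) (Nat.cast_nonneg _)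

theorem card_mul_splitGain (S : Dataset X) (g : X → Bool) :
    (S.card : ℝ) * splitGain S g * Real.log 2
      = dataEntropy S - dataEntropy (child S g false) - dataEntropy (child S g true) := by
  rw [← card_mul_splitEntropy S, ← card_mul_splitEntropy (child S g false),
    ← card_mul_splitEntropy (child S g true), splitGain]
  have hch : (child S g true).card ≤ S.card ∧ (child S g false).card ≤ S.card :=
    ⟨Multiset.card_le_card (Multiset.filter_le _ _), Multiset.card_le_card (Multiset.filter_le _ _)⟩
  rcases Nat.eq_zero_or_pos S.card with h | h
  · have h1 : (child S g true).card = 0 := by omega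
    have h2 : (child S g false).card = 0 := by omega
    simp [h, h1, h2]
  · have : (S.card : ℝ) ≠ 0 := by positivity
    field_simp

theorem dataEntropy_nonneg (S : Dataset X) : 0 ≤ dataEntropy S :=
  labelEntropy_nonneg (Nat.cast_nonneg _) (Nat.cast_nonneg _)

theorem dataEntropy_le (S : Dataset X) : dataEntropy S ≤ S.card * Real.log 2 := by
  refine (labelEntropy_le_log_two (Nat.cast_nonneg _) (Nat.cast_nonneg _)).trans_eq ?_
  rw [← labelCount_add S]
  push_cast
  rfl

theorem dataEntropy_zero : dataEntropy (0 : Dataset X) = 0 := by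
  simp [dataEntropy, labelEntropy, labelCount]

/-- The number of points of `S` that the best constant classifier gets wrong. -/
def minority (S : Dataset X) : ℕ := min (labelCount true S) (labelCount false S)

theorem two_mul_minority_le (S : Dataset X) : 2 * minority S ≤ S.card := by
  have := labelCount_add S
  unfold minority
  omega

theorem minority_zero : minority (0 : Dataset X) = 0 := by
  simp [minority, labelCount]

theorem minority_child_add_le (S : Dataset X) (g : X → Bool) :
    minority (child S g false) + minority (child S g true) ≤ minority S := by
  have h1 := labelCount_child_add true S g
  have h2 := labelCount_child_add false S g
  unfold minority
  omega

theorem minority_mul_log_two_le (S : Dataset X) :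
    (minority S : ℝ) * Real.log 2 ≤ dataEntropy S := by
  have h := min_mul_log_two_le_labelEntropy (Nat.cast_nonneg (α := ℝ) (labelCount true S))
    (Nat.cast_nonneg (α := ℝ) (labelCount false S))
  unfold minority
  push_cast
  exact h

theorem dataEntropy_le_minority (S : Dataset X) {p : ℝ} (hp : 0 < p) (hp1 : p < 1) :
    dataEntropy S ≤ minority S * -Real.log p + S.card * -Real.log (1 - p) := by
  have hc : (labelCount true S : ℝ) + labelCount false S = S.card := by
    exact_mod_cast labelCount_add S
  have ha : (0 : ℝ) ≤ labelCount true S := Nat.cast_nonneg _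
  have hb : (0 : ℝ) ≤ labelCount false S := Nat.cast_nonneg _
  have hl : Real.log (1 - p) ≤ 0 := Real.log_nonpos (by linarith) (by linarith)
  rw [← hc, minority]
  push_cast
  unfold dataEntropy
  rcases le_total (labelCount true S : ℝ) (labelCount false S) with h | h
  · rw [min_eq_left h]
    have := labelEntropy_le_cross ha hb hp hp1
    nlinarith
  · rw [min_eq_right h, labelEntropy_comm]
    have := labelEntropy_le_cross hb ha hp hp1
    nlinarith

theorem abs_card_mul_splitGain_le (S : Dataset X) (g : X → Bool) :
    |(S.card : ℝ) * splitGain S g| ≤ S.card := by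
  have hl : 0 < Real.log 2 := Real.log_pos one_lt_two
  have h := card_mul_splitGain S g
  have h0 := dataEntropy_nonneg S
  have h1 := dataEntropy_le S
  have h2 := dataEntropy_nonneg (child S g true)
  have h3 := dataEntropy_le (child S g true)
  have h4 := dataEntropy_nonneg (child S g false)
  have h5 := dataEntropy_le (child S g false)
  have hc : ((child S g true).card : ℝ) + (child S g false).card = S.card := by
    rw [← labelCount_add S, ← labelCount_add, ← labelCount_add, ← labelCount_child_add true S g,
      ← labelCount_child_add false S g]
    push_cast
    ring
  rw [abs_le]
  constructor
  · refine le_of_mul_le_mul_right ?_ hl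
    rw [h, ← hc]
    linarith
  · refine le_of_mul_le_mul_right ?_ hl
    rw [h]
    linarith

theorem labelCount_cons_le (y : Bool) (z : X × Bool) (R : Dataset X) :
    labelCount y R ≤ labelCount y (z ::ₘ R) ∧ labelCount y (z ::ₘ R) ≤ labelCount y R + 1 := by
  unfold labelCount
  rw [Multiset.countP_cons]
  split_ifs <;> omega

theorem labelCount_child_cons_le (y i : Bool) (g : X → Bool) (z : X × Bool) (R : Dataset X) :
    labelCount y (child R g i) ≤ labelCount y (child (z ::ₘ R) g i) ∧
      labelCount y (child (z ::ₘ R) g i) ≤ labelCount y (child R g i) + 1 := by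
  unfold child
  rw [Multiset.filter_cons]
  split_ifs
  · rw [Multiset.singleton_add]
    exact labelCount_cons_le _ _ _
  · rw [zero_add]
    omega

theorem card_child_cons_le (i : Bool) (g : X → Bool) (z : X × Bool) (R : Dataset X) :
    (child R g i).card ≤ (child (z ::ₘ R) g i).card ∧
      (child (z ::ₘ R) g i).card ≤ (child R g i).card + 1 := by
  unfold child
  rw [Multiset.filter_cons]
  split_ifs <;> simp

theorem labelCount_child_le_card (y i : Bool) (g : X → Bool) (S : Dataset X) :
    labelCount y (child S g i) ≤ S.card :=
  (Multiset.countP_le_card _ _).trans (Multiset.card_le_card (Multiset.filter_le _ _))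

/-- The sensitivity of the information gain. -/
theorem abs_splitGain_sub_le {S S' : Dataset X} (hn : Neighbouring S S') (g : X → Bool) :
    (S.card : ℝ) * |splitGain S g - splitGain S' g| * Real.log 2
      ≤ 8 * (1 + Real.log S.card) := by
  obtain ⟨R, a, b, rfl, rfl⟩ := hn
  set S := a ::ₘ R with hS
  set S' := b ::ₘ R with hS'
  have hcard : S'.card = S.card := by simp [hS, hS']
  have hl : 0 < Real.log 2 := Real.log_pos one_lt_two
  have hsum : ∀ D : Dataset X, (labelCount true D : ℝ) + labelCount false D = D.card := fun D => by
    exact_mod_cast labelCount_add D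
  have hexp : ∀ D : Dataset X, (D.card : ℝ) * splitGain D g * Real.log 2 =
      D.card * Real.log D.card - labelCount true D * Real.log (labelCount true D)
      - labelCount false D * Real.log (labelCount false D)
      - ((child D g false).card * Real.log (child D g false).card
        - labelCount true (child D g false) * Real.log (labelCount true (child D g false))
        - labelCount false (child D g false) * Real.log (labelCount false (child D g false)))
      - ((child D g true).card * Real.log (child D g true).card
        - labelCount true (child D g true) * Real.log (labelCount true (child D g true))
        - labelCount false (child D g true) * Real.log (labelCount false (child D g true))) := by
    intro D
    rw [card_mul_splitGain]
    simp only [dataEntropy, labelEntropy, hsum]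
  have h1 := hexp S
  have h2 := hexp S'
  rw [hcard] at h2
  have hlab : ∀ y, |(labelCount y S : ℝ) * Real.log (labelCount y S)
      - labelCount y S' * Real.log (labelCount y S')| ≤ 1 + Real.log S.card := by
    intro y
    have p := labelCount_cons_le y a R
    have q := labelCount_cons_le y b R
    rw [← hS] at p
    rw [← hS'] at q
    refine abs_mul_log_sub_le (Multiset.countP_le_card _ _)
      (hcard ▸ Multiset.countP_le_card _ _) ?_ ?_ <;> omega
  have hcl : ∀ y i, |(labelCount y (child S g i) : ℝ) * Real.log (labelCount y (child S g i))
      - labelCount y (child S' g i) * Real.log (labelCount y (child S' g i))|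
        ≤ 1 + Real.log S.card := by
    intro y i
    have p := labelCount_child_cons_le y i g a R
    have q := labelCount_child_cons_le y i g b R
    rw [← hS] at p
    rw [← hS'] at q
    refine abs_mul_log_sub_le (labelCount_child_le_card _ _ _ _)
      (hcard ▸ labelCount_child_le_card _ _ _ _) ?_ ?_ <;> omega
  have hcc : ∀ i, |((child S g i).card : ℝ) * Real.log (child S g i).card
      - (child S' g i).card * Real.log (child S' g i).card| ≤ 1 + Real.log S.card := by
    intro i
    have p := card_child_cons_le i g a R
    have q := card_child_cons_le i g b R
    rw [← hS] at p
    rw [← hS'] at q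
    refine abs_mul_log_sub_le (Multiset.card_le_card (Multiset.filter_le _ _))
      (hcard ▸ Multiset.card_le_card (Multiset.filter_le _ _)) ?_ ?_ <;> omega
  have e : (S.card : ℝ) * |splitGain S g - splitGain S' g| * Real.log 2
      = |S.card * splitGain S g * Real.log 2 - S.card * splitGain S' g * Real.log 2| := by
    rw [← sub_mul, ← mul_sub, abs_mul, abs_mul, abs_of_pos hl, Nat.abs_cast]
  have l1 := abs_le.mp (hlab true)
  have l2 := abs_le.mp (hlab false)
  have l3 := abs_le.mp (hcl true true)
  have l4 := abs_le.mp (hcl true false)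
  have l5 := abs_le.mp (hcl false true)
  have l6 := abs_le.mp (hcl false false)
  have l7 := abs_le.mp (hcc true)
  have l8 := abs_le.mp (hcc false)
  rw [e, h1, h2, abs_le]
  constructor <;> linarith [l1.1, l1.2, l2.1, l2.2, l3.1, l3.2, l4.1, l4.2, l5.1, l5.2, l6.1, l6.2,
    l7.1, l7.2, l8.1, l8.2]

theorem gainSensitivity_bounds {k : ℕ} (h : Fin k → X → Bool) (m : ℕ) :
    0 ≤ gainSensitivity h m ∧ m * gainSensitivity h m ≤ 16 * (1 + Real.log m) := by
  unfold gainSensitivity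
  have hlm := Real.log_natCast_nonneg m
  constructor
  · refine Real.sSup_nonneg ?_
    rintro r ⟨j, S, S', -, -, rfl⟩
    exact abs_nonneg _
  · rcases Nat.eq_zero_or_pos m with rfl | hm
    · simp
    have hm' : (0 : ℝ) < m := by exact_mod_cast hm
    rw [← le_div_iff₀' hm']
    refine Real.sSup_le ?_ (by positivity)
    rintro r ⟨j, S, S', rfl, hn, rfl⟩
    have h1 := abs_splitGain_sub_le hn (h j)
    have h2 := Real.log_two_gt_d9
    rw [le_div_iff₀' hm']
    have h3 : 0 ≤ (S.card : ℝ) * |splitGain S (h j) - splitGain S' (h j)| := by positivity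
    nlinarith

theorem gainSensitivityBound_bounds (m : ℕ) :
    0 ≤ gainSensitivityBound m ∧ m * gainSensitivityBound m ≤ 16 * (1 + Real.log m) := by
  unfold gainSensitivityBound
  have hlm := Real.log_natCast_nonneg m
  have hl : 0 < Real.log 2 := Real.log_pos one_lt_two
  have hb : 0 ≤ Real.logb 2 m := div_nonneg hlm hl.le
  refine ⟨by positivity, ?_⟩
  rcases Nat.eq_zero_or_pos m with rfl | hm
  · simp
  have hm' : (0 : ℝ) < m := by exact_mod_cast hm
  have h1 : Real.logb 2 m * Real.log 2 = Real.log m := by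
    rw [Real.logb, div_mul_cancel₀ _ hl.ne']
  have h2 := Real.log_two_gt_d9
  rw [mul_div_cancel₀ _ hm'.ne']
  nlinarith

end Datasets

theorem toReal_toOuterMeasure_ofMultiset {X : Type*} (W : Multiset X) (hW : W ≠ 0) (t : Set X)
    [DecidablePred (· ∈ t)] :
    ((PMF.ofMultiset W hW).toOuterMeasure t).toReal = (W.countP (· ∈ t) : ℝ) / W.card := by
  classical
  rw [PMF.toOuterMeasure_ofMultiset_apply]
  have : (∑' x, ((W.filter (· ∈ t)).count x : ENNReal)) = (W.countP (· ∈ t) : ENNReal) := by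
    rw [tsum_eq_sum (s := (W.filter (· ∈ t)).toFinset)]
    · rw [← Nat.cast_sum, Multiset.toFinset_sum_count_eq, Multiset.countP_eq_card_filter]
    · intro x hx
      rw [Nat.cast_eq_zero, Multiset.count_eq_zero]
      simpa using hx
  rw [ENNReal.toReal_div, ENNReal.toReal_natCast, ← ENNReal.toReal_natCast (W.countP (· ∈ t)),
    ← this]
  congr!

section Learning

variable {X : Type*} {k : ℕ} {h : Fin k → X → Bool} {f : X → Bool} {γ : ℝ}

theorem WeakLearning.le_half (hw : WeakLearning h f γ) (x : X) : γ ≤ 1 / 2 := by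
  obtain ⟨j, hj⟩ := hw (PMF.pure x)
  have := ENNReal.toReal_nonneg (a := (PMF.pure x).toOuterMeasure {x | h j x ≠ f x})
  linarith

/-- The Weak Learning Assumption for the distribution that gives equal weight to both labels. -/
theorem WeakLearning.exists_separating (hw : WeakLearning h f γ) {D : Dataset X}
    (hD : ∀ z ∈ D, z.2 = f z.1) (hp : 0 < labelCount true D) (hq : 0 < labelCount false D) :
    ∃ j, 2 * γ * ((labelCount true D : ℝ) * labelCount false D)
      ≤ labelCount true (child D (h j) true) * labelCount false D
        - labelCount false (child D (h j) true) * labelCount true D := by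
  classical
  set p := labelCount true D with hpdef
  set q := labelCount false D with hqdef
  set W : Multiset X := q • (D.filter fun z => z.2 = true).map Prod.fst
    + p • (D.filter fun z => z.2 = false).map Prod.fst with hWdef
  have hcard : W.card = 2 * (p * q) := by
    rw [hWdef, Multiset.card_add, Multiset.card_nsmul, Multiset.card_nsmul, Multiset.card_map,
      Multiset.card_map, ← Multiset.countP_eq_card_filter, ← Multiset.countP_eq_card_filter]
    change q • p + p • q = _
    simp only [smul_eq_mul]
    ring
  have hW : W ≠ 0 := by
    intro h0
    rw [h0, Multiset.card_zero] at hcard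
    have := Nat.mul_pos hp hq
    omega
  obtain ⟨j, hj⟩ := hw (PMF.ofMultiset W hW)
  refine ⟨j, ?_⟩
  have herr : W.countP (· ∈ {x | h j x ≠ f x})
      = q * labelCount true (child D (h j) false) + p * labelCount false (child D (h j) true) := by
    rw [hWdef, Multiset.countP_add, Multiset.countP_nsmul, Multiset.countP_nsmul,
      Multiset.countP_map, Multiset.countP_map]
    unfold labelCount child
    rw [Multiset.filter_filter, Multiset.filter_filter, Multiset.countP_filter,
      Multiset.countP_filter, ← Multiset.countP_eq_card_filter, ← Multiset.countP_eq_card_filter]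
    congr 2
    · refine Multiset.countP_congr rfl fun z hz => ?_
      have := hD z hz
      cases h1 : h j z.1 <;> cases h2 : f z.1 <;> simp_all
    · refine Multiset.countP_congr rfl fun z hz => ?_
      have := hD z hz
      cases h1 : h j z.1 <;> cases h2 : f z.1 <;> simp_all
  rw [toReal_toOuterMeasure_ofMultiset, herr, hcard, div_le_iff₀ (by positivity)] at hj
  have hc : (labelCount true (child D (h j) true) : ℝ) + labelCount true (child D (h j) false)
      = p := by exact_mod_cast labelCount_child_add true D (h j)
  push_cast at hj
  have : (labelCount true (child D (h j) false) : ℝ)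
    = p - labelCount true (child D (h j) true) := by linarith
  rw [this] at hj
  linarith

theorem WeakLearning.exists_gain (hw : WeakLearning h f γ) (hγ : 0 < γ) {D : Dataset X}
    (hD : ∀ z ∈ D, z.2 = f z.1) (hm : 0 < minority D) :
    ∃ j, γ ^ 2 / 2 * minority D ≤ D.card * splitGain D (h j) := by
  have hp : 0 < labelCount true D := hm.trans_le (min_le_left _ _)
  have hq : 0 < labelCount false D := hm.trans_le (min_le_right _ _)
  obtain ⟨j, hj⟩ := hw.exists_separating hD hp hq
  refine ⟨j, ?_⟩
  have hct : (labelCount true D : ℝ) = labelCount true (child D (h j) true)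
      + labelCount true (child D (h j) false) := by
    exact_mod_cast (labelCount_child_add true D (h j)).symm
  have hcf : (labelCount false D : ℝ) = labelCount false (child D (h j) true)
      + labelCount false (child D (h j) false) := by
    exact_mod_cast (labelCount_child_add false D (h j)).symm
  have hp' : (0 : ℝ) < labelCount true D := by exact_mod_cast hp
  have hq' : (0 : ℝ) < labelCount false D := by exact_mod_cast hq
  have hgain := card_mul_splitGain D (h j)
  have hmin : (minority D : ℝ) = min (labelCount true D : ℝ) (labelCount false D) := by
    unfold minority
    push_cast
    rfl
  have hmain := labelEntropy_gain (a := labelCount true (child D (h j) true))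
    (b := labelCount false (child D (h j) true)) (c := labelCount true (child D (h j) false))
    (d := labelCount false (child D (h j) false)) (γ := γ) (Nat.cast_nonneg _) (Nat.cast_nonneg _)
    (Nat.cast_nonneg _) (Nat.cast_nonneg _) (by rwa [← hct]) (by rwa [← hcf]) hγ
    (by rwa [← hct, ← hcf])
  rw [← hct, ← hcf, ← hmin] at hmain
  have hl1 : Real.log 2 ≤ 1 := by have := Real.log_two_lt_d9; linarith
  have hl : 0 < Real.log 2 := Real.log_pos one_lt_two
  have h0 : 0 ≤ γ ^ 2 / 2 * (minority D : ℝ) := by positivity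
  have h1 : γ ^ 2 / 2 * (minority D : ℝ) ≤ D.card * splitGain D (h j) * Real.log 2 := by
    rw [hgain]
    refine hmain.trans_eq ?_
    simp only [dataEntropy]
    ring
  have h2 : 0 ≤ (D.card : ℝ) * splitGain D (h j) :=
    nonneg_of_mul_nonneg_left (h0.trans h1) hl
  nlinarith

end Learning

section NoisyMax

theorem le_argmaxFin {k : ℕ} [NeZero k] (g : Fin k → ℝ) (j : Fin k) : g j ≤ g (argmaxFin g) := by
  unfold argmaxFin
  cases hm : (List.finRange k).argmax g with
  | none =>
    rw [List.argmax_eq_none] at hm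
    exact absurd (List.mem_finRange j) (by simp [hm])
  | some m => exact List.le_of_mem_argmax (List.mem_finRange j) hm

theorem reportNoisyMax_spec {k : ℕ} [NeZero k] {score Z : Fin k → ℝ} {Δ α η : ℝ}
    (hZ : ∀ j, |2 * Δ / α * Z j| ≤ η) :
    |(reportNoisyMax score Δ α Z).2 - score (reportNoisyMax score Δ α Z).1| ≤ η ∧
      ∀ j, score j - η ≤ (reportNoisyMax score Δ α Z).2 := by
  constructor
  · refine le_trans (le_of_eq ?_) (hZ (reportNoisyMax score Δ α Z).1)
    exact congrArg _ (add_sub_cancel_left _ _)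
  · intro j
    refine le_trans ?_ (le_argmaxFin (fun i => score i + 2 * Δ / α * Z i) j)
    have := (abs_le.mp (hZ j)).1
    linarith

variable {X : Type*} {k : ℕ} [NeZero k] {h : Fin k → X → Bool} {Δ : ℕ → ℝ}

theorem rnmSplit_spec {D : Dataset X} {a δ τ : ℝ} {Z : Fin k → ℝ} (hD : 0 < D.card) (ha : 0 < a)
    (hΔ : 0 ≤ Δ D.card ∧ D.card * Δ D.card ≤ 16 * (1 + Real.log D.card)) (hZ : ∀ j, |Z j| ≤ τ) :
    D.card * |(rnmSplit h Δ D a δ Z).2 - splitGain D (h (rnmSplit h Δ D a δ Z).1)|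
        ≤ 32 * τ * (1 + Real.log D.card) / a ∧
      ∀ j, D.card * splitGain D (h j) - 32 * τ * (1 + Real.log D.card) / a
        ≤ D.card * (rnmSplit h Δ D a δ Z).2 := by
  have hn : (0 : ℝ) < D.card := by exact_mod_cast hD
  have hτ : 0 ≤ τ := (abs_nonneg _).trans (hZ 0)
  have hη : ∀ j, |2 * Δ D.card / a * Z j| ≤ 32 * τ * (1 + Real.log D.card) / a / D.card := by
    intro j
    rw [abs_mul, abs_of_nonneg (div_nonneg (mul_nonneg zero_le_two hΔ.1) ha.le), le_div_iff₀ hn,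
      le_div_iff₀ ha]
    calc 2 * Δ D.card / a * |Z j| * D.card * a = 2 * (D.card * Δ D.card) * |Z j| := by
          field_simp
      _ ≤ 2 * (16 * (1 + Real.log D.card)) * τ := by
          have h0 := mul_nonneg hn.le hΔ.1
          exact mul_le_mul (by linarith [hΔ.2]) (hZ j) (abs_nonneg _) (by linarith [hΔ.2])
      _ = 32 * τ * (1 + Real.log D.card) := by ring
  obtain ⟨h1, h2⟩ := reportNoisyMax_spec (score := fun j => splitGain D (h j)) hη
  constructor
  · rw [← le_div_iff₀' hn]
    exact h1
  · intro j
    have := mul_le_mul_of_nonneg_left (h2 j) hn.le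
    rw [mul_sub, mul_div_cancel₀ _ hn.ne'] at this
    exact this

theorem countP_noisyLabel_le {X : Type*} {k : ℕ} {S : Dataset X} {α τ : ℝ} {ω : Tape k}
    {T : DecTree X} {c : ℕ} (hα : 0 < α) (hω : ∀ y, |ω (c, .label y)| ≤ τ) :
    ((T.leafData S c).countP fun z => noisyLabel S α ω T c ≠ z.2 : ℝ)
      ≤ minority (T.leafData S c) + 8 * τ / α := by
  set D := T.leafData S c with hD
  have hη : ∀ y : Fin 2, |2 * 1 / (α / 2) * ω (c, .label y)| ≤ 4 * τ / α := by
    intro y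
    rw [abs_mul, abs_of_pos (by positivity), le_div_iff₀ hα]
    calc 2 * 1 / (α / 2) * |ω (c, .label y)| * α = 4 * |ω (c, .label y)| := by
          field_simp; ring
      _ ≤ 4 * τ := by linarith [hω y]
  obtain ⟨h1, h2⟩ := reportNoisyMax_spec
    (score := fun y : Fin 2 => ((D.countP fun z => z.2 = finTwoEquiv y : ℕ) : ℝ)) hη
  set r := reportNoisyMax
    (fun y : Fin 2 => ((D.countP fun z => z.2 = finTwoEquiv y : ℕ) : ℝ)) 1 (α / 2)
    (fun y => ω (c, .label y)) with hr
  have hlab : noisyLabel S α ω T c = finTwoEquiv r.1 := rfl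
  have hle : ∀ y : Bool, (labelCount y D : ℝ) ≤ labelCount (finTwoEquiv r.1) D + 8 * τ / α := by
    intro y
    have h3 := h2 (finTwoEquiv.symm y)
    simp only [Equiv.apply_symm_apply] at h3
    have h4 := (abs_le.mp h1).2
    unfold labelCount
    have : 8 * τ / α = 4 * τ / α + 4 * τ / α := by ring
    linarith
  have hτ : 0 ≤ 8 * τ / α := div_nonneg (by linarith [(abs_nonneg _).trans (hω 0)]) hα.le
  have hwrong : (D.countP fun z => noisyLabel S α ω T c ≠ z.2)
      = labelCount (!finTwoEquiv r.1) D := by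
    rw [hlab]
    refine Multiset.countP_congr rfl fun z _ => ?_
    cases finTwoEquiv r.1 <;> cases z.2 <;> simp
  rw [hwrong, minority]
  push_cast
  have ht := hle true
  have hf := hle false
  cases hb : finTwoEquiv r.1
  · rw [hb] at ht
    simp only [Bool.not_false]
    rcases min_choice (labelCount true D : ℝ) (labelCount false D) with hm | hm <;> rw [hm] <;>
      linarith
  · rw [hb] at hf
    simp only [Bool.not_true]
    rcases min_choice (labelCount true D : ℝ) (labelCount false D) with hm | hm <;> rw [hm] <;>
      linarith

end NoisyMax

section Trees

variable {X : Type*}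

theorem DecTree.route_splitLeaf (ℓ : ℕ) (g : X → Bool) (c₀ c₁ : ℕ) (T : DecTree X) (x : X) :
    (T.splitLeaf ℓ g c₀ c₁).route x
      = if T.route x = ℓ then (if g x then c₁ else c₀) else T.route x := by
  induction T with
  | leaf id =>
    unfold splitLeaf
    split_ifs with h1 h2 <;> simp_all [route]
  | node g' l r ihl ihr =>
    simp only [splitLeaf, route]
    split_ifs <;> simp_all

theorem DecTree.leafData_eq_zero {T : DecTree X} {S : Dataset X} {c : ℕ}
    (hc : ∀ x, T.route x ≠ c) : T.leafData S c = 0 := by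
  unfold leafData
  rw [Multiset.filter_eq_nil]
  exact fun z _ => hc z.1

variable {T : DecTree X} {S : Dataset X} {ℓ c₀ c₁ : ℕ} {g : X → Bool}

theorem DecTree.leafData_splitLeaf_of_ne {c : ℕ} (h : c ≠ ℓ) (h0 : c ≠ c₀) (h1 : c ≠ c₁) :
    (T.splitLeaf ℓ g c₀ c₁).leafData S c = T.leafData S c := by
  unfold leafData
  refine Multiset.filter_congr fun z _ => ?_
  rw [route_splitLeaf]
  split_ifs with h2 h3
  · exact ⟨fun h' => absurd h'.symm h1, fun h' => absurd (h'.symm.trans h2) h⟩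
  · exact ⟨fun h' => absurd h'.symm h0, fun h' => absurd (h'.symm.trans h2) h⟩
  · rfl

theorem DecTree.leafData_splitLeaf_false (h0 : ∀ x, T.route x ≠ c₀) (h01 : c₀ ≠ c₁) :
    (T.splitLeaf ℓ g c₀ c₁).leafData S c₀ = child (T.leafData S ℓ) g false := by
  unfold leafData child
  rw [Multiset.filter_filter]
  refine Multiset.filter_congr fun z _ => ?_
  rw [route_splitLeaf]
  have := h0 z.1
  split_ifs with h2 h3 <;> simp_all [Ne.symm h01]

theorem DecTree.leafData_splitLeaf_true (h1 : ∀ x, T.route x ≠ c₁) (h01 : c₀ ≠ c₁) :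
    (T.splitLeaf ℓ g c₀ c₁).leafData S c₁ = child (T.leafData S ℓ) g true := by
  unfold leafData child
  rw [Multiset.filter_filter]
  refine Multiset.filter_congr fun z _ => ?_
  rw [route_splitLeaf]
  have := h1 z.1
  split_ifs with h2 h3 <;> simp_all

theorem DecTree.leafData_splitLeaf_self (h0 : ℓ ≠ c₀) (h1 : ℓ ≠ c₁) :
    (T.splitLeaf ℓ g c₀ c₁).leafData S ℓ = 0 := by
  refine leafData_eq_zero fun x => ?_
  rw [route_splitLeaf]
  split_ifs with h2 h3
  · exact h1.symm
  · exact h0.symm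
  · exact h2

/-- Splitting a leaf replaces its contribution to a sum over the leaves by those of its children. -/
theorem DecTree.sum_leafData_splitLeaf {A : Type*} [AddCommGroup A] (φ : Dataset X → A)
    (hφ : φ 0 = 0) {m : ℕ} (hℓ : ℓ < m) (hc₀ : c₀ < m) (hc₁ : c₁ < m) (h0 : ∀ x, T.route x ≠ c₀)
    (h1 : ∀ x, T.route x ≠ c₁) (h01 : c₀ ≠ c₁) (hℓ0 : ℓ ≠ c₀) (hℓ1 : ℓ ≠ c₁) :
    ∑ c ∈ Finset.range m, φ ((T.splitLeaf ℓ g c₀ c₁).leafData S c) + φ (T.leafData S ℓ)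
      = ∑ c ∈ Finset.range m, φ (T.leafData S c) + φ (child (T.leafData S ℓ) g false)
        + φ (child (T.leafData S ℓ) g true) := by
  have key : ∀ c, φ ((T.splitLeaf ℓ g c₀ c₁).leafData S c)
      + (if c = ℓ then φ (T.leafData S ℓ) else 0)
      = φ (T.leafData S c) + (if c = c₀ then φ (child (T.leafData S ℓ) g false) else 0)
        + (if c = c₁ then φ (child (T.leafData S ℓ) g true) else 0) := by
    intro c
    by_cases hcℓ : c = ℓ
    · subst hcℓ
      simp [hℓ0, hℓ1, leafData_splitLeaf_self hℓ0 hℓ1, hφ]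
    by_cases hcc0 : c = c₀
    · subst hcc0
      simp [hcℓ, h01, leafData_splitLeaf_false h0 h01, leafData_eq_zero h0, hφ]
    by_cases hcc1 : c = c₁
    · subst hcc1
      simp [hcℓ, hcc0, leafData_splitLeaf_true h1 h01, leafData_eq_zero h1, hφ]
    simp [hcℓ, hcc0, hcc1, leafData_splitLeaf_of_ne hcℓ hcc0 hcc1]
  have hsum := Finset.sum_congr (rfl : Finset.range m = Finset.range m) fun c _ => key c
  simp only [Finset.sum_add_distrib, Finset.sum_ite_eq', Finset.mem_range, hℓ, hc₀, hc₁,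
    if_true] at hsum
  exact hsum

theorem DecTree.sum_countP_leafData {m : ℕ} (hT : ∀ x, T.route x < m) (P : X × Bool → Prop)
    [DecidablePred P] : ∑ c ∈ Finset.range m, (T.leafData S c).countP P = S.countP P := by
  unfold leafData
  induction S using Multiset.induction_on with
  | empty => simp
  | cons z S ih =>
    simp only [Multiset.countP_filter] at ih ⊢
    simp only [Multiset.countP_cons, Finset.sum_add_distrib, ih]
    congr 1
    by_cases hz : P z <;> simp [hz, hT z.1]

theorem DecTree.sum_card_leafData {m : ℕ} (hT : ∀ x, T.route x < m) :
    ∑ c ∈ Finset.range m, (T.leafData S c).card = S.card := by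
  have := sum_countP_leafData (S := S) hT fun _ => True
  simpa using this

end Trees

section Run

variable {X : Type*} {k : ℕ}

/-- The invariant of DP-TopDown: at most `t + 1` leaves, with identifiers at most `2 * t`, each of
which either has an entry in the queue or data with the property `Light`; the entries in the queue
are related to the data at their leaf by `Good`. -/
def TopDownInvariant (Good : Dataset X → QueueEntry k → Prop) (Light : Dataset X → Prop)
    (S : Dataset X) (t : ℕ) (s : TopDownState X k) : Prop :=
  ∃ A : Finset ℕ, A.card ≤ t + 1 ∧ (∀ a ∈ A, a < 2 * t + 1) ∧ (∀ x, s.tree.route x ∈ A) ∧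
    (∀ e ∈ s.queue, e.leaf ∈ A ∧ Good (s.tree.leafData S e.leaf) e) ∧
    ∀ a ∈ A, (∃ e ∈ s.queue, e.leaf = a) ∨ Light (s.tree.leafData S a)

variable {Good : Dataset X → QueueEntry k → Prop} {Light : Dataset X → Prop}
  {split : SplitRoutine X k} {B : ℕ → ℝ} {h : Fin k → X → Bool}
  {S : Dataset X} {M : ℕ} {ε α δ : ℝ} {ω : Tape k} {t : ℕ} {s : TopDownState X k}

theorem topDownStep_of_queue_nil (hs : s.queue = []) :
    topDownStep split B h S M ε α δ ω t s = s := by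
  simp [topDownStep, hs]

theorem exists_queue_argmax (hs : s.queue ≠ []) :
    ∃ e ∈ s.queue, (∀ e' ∈ s.queue, e'.priority ≤ e.priority) ∧
      s.queue.argmax QueueEntry.priority = some e := by
  cases hm : s.queue.argmax QueueEntry.priority with
  | none => exact absurd (List.argmax_eq_none.mp hm) hs
  | some e =>
    exact ⟨e, List.argmax_mem hm, fun e' he' => List.le_of_mem_argmax he' hm, rfl⟩

theorem topDownStep_tree {e : QueueEntry k} (he : s.queue.argmax QueueEntry.priority = some e) :
    (topDownStep split B h S M ε α δ ω t s).tree
      = s.tree.splitLeaf e.leaf (h e.split) (2 * t + 1) (2 * t + 2) := by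
  simp [topDownStep, he]

theorem TopDownInvariant.route_lt (hs : TopDownInvariant Good Light S t s) (x : X) : s.tree.route x < 2 * t + 1 := by
  obtain ⟨A, -, hlt, hroute, -⟩ := hs
  exact hlt _ (hroute x)

theorem TopDownInvariant.step (hs : TopDownInvariant Good Light S t s)
    (hpush : ∀ (T : DecTree X) (c d : ℕ), c ≤ 2 * t + 2 →
      (topDownPush split B S M ε α δ ω T c d = [] ∧ Light (T.leafData S c)) ∨
      ∃ e, topDownPush split B S M ε α δ ω T c d = [e] ∧ e.leaf = c ∧ Good (T.leafData S c) e) :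
    TopDownInvariant Good Light S (t + 1) (topDownStep split B h S M ε α δ ω t s) := by
  obtain ⟨A, hcard, hlt, hroute, hgood, hlight⟩ := hs
  cases hm : s.queue.argmax QueueEntry.priority with
  | none =>
    rw [topDownStep_of_queue_nil (List.argmax_eq_none.mp hm)]
    exact ⟨A, by omega, fun a ha => by have := hlt a ha; omega, hroute, hgood, hlight⟩
  | some e =>
    have heA := (hgood e (List.argmax_mem hm)).1
    have heℓ := hlt _ heA
    set T := s.tree.splitLeaf e.leaf (h e.split) (2 * t + 1) (2 * t + 2) with hT
    have hstep : topDownStep split B h S M ε α δ ω t s =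
        { tree := T
          queue := s.queue.filter (fun e' => e'.leaf ≠ e.leaf)
            ++ topDownPush split B S M ε α δ ω T (2 * t + 1) (e.depth + 1)
            ++ topDownPush split B S M ε α δ ω T (2 * t + 2) (e.depth + 1) } := by
      simp [topDownStep, hm, hT]
    have hold : ∀ a ∈ A, a ≠ e.leaf → T.leafData S a = s.tree.leafData S a := by
      intro a ha hne
      have := hlt a ha
      exact DecTree.leafData_splitLeaf_of_ne hne (by omega) (by omega)
    have hnew : ∀ c d, c ≤ 2 * t + 2 → ∀ e' ∈ topDownPush split B S M ε α δ ω T c d,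
        e'.leaf = c ∧ Good (T.leafData S c) e' := by
      intro c d hc e' he'
      rcases hpush T c d hc with ⟨h1, -⟩ | ⟨e₁, h1, h2, h3⟩
      · rw [h1] at he'
        simp at he'
      · rw [h1, List.mem_singleton] at he'
        subst he'
        exact ⟨h2, h3⟩
    have hnew' : ∀ c d, c ≤ 2 * t + 2 →
        (∃ e' ∈ topDownPush split B S M ε α δ ω T c d, e'.leaf = c) ∨ Light (T.leafData S c) := by
      intro c d hc
      rcases hpush T c d hc with ⟨-, h1⟩ | ⟨e₁, h1, h2, h3⟩
      · exact Or.inr h1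
      · exact Or.inl ⟨e₁, by rw [h1]; exact List.mem_singleton_self _, h2⟩
    rw [hstep]
    refine ⟨insert (2 * t + 1) (insert (2 * t + 2) (A.erase e.leaf)), ?_, ?_, ?_, ?_, ?_⟩
    · have h1 := Finset.card_insert_le (2 * t + 1) (insert (2 * t + 2) (A.erase e.leaf))
      have h2 := Finset.card_insert_le (2 * t + 2) (A.erase e.leaf)
      have h3 := Finset.card_erase_of_mem heA
      have h4 := Finset.card_pos.mpr ⟨_, heA⟩
      omega
    · intro a ha
      simp only [Finset.mem_insert, Finset.mem_erase] at ha
      rcases ha with rfl | rfl | ⟨-, ha⟩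
      · omega
      · omega
      · have := hlt a ha
        omega
    · intro x
      have := hroute x
      simp only [Finset.mem_insert, Finset.mem_erase]
      rw [hT, DecTree.route_splitLeaf]
      split_ifs <;> simp_all
    · intro e' he'
      simp only [List.mem_append, List.mem_filter, decide_eq_true_eq] at he'
      simp only [Finset.mem_insert, Finset.mem_erase]
      rcases he' with (⟨hq, hne⟩ | he') | he'
      · obtain ⟨h1, h2⟩ := hgood e' hq
        rw [hold _ h1 hne]
        exact ⟨Or.inr (Or.inr ⟨hne, h1⟩), h2⟩
      · obtain ⟨h1, h2⟩ := hnew _ _ (by omega) e' he'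
        rw [h1]
        exact ⟨Or.inl rfl, h2⟩
      · obtain ⟨h1, h2⟩ := hnew _ _ (by omega) e' he'
        rw [h1]
        exact ⟨Or.inr (Or.inl rfl), h2⟩
    · intro a ha
      simp only [Finset.mem_insert, Finset.mem_erase] at ha
      simp only [List.mem_append, List.mem_filter, decide_eq_true_eq]
      rcases ha with rfl | rfl | ⟨hne, ha⟩
      · rcases hnew' (2 * t + 1) (e.depth + 1) (by omega) with ⟨e', h1, h2⟩ | h1
        · exact Or.inl ⟨e', Or.inl (Or.inr h1), h2⟩
        · exact Or.inr h1
      · rcases hnew' (2 * t + 2) (e.depth + 1) (by omega) with ⟨e', h1, h2⟩ | h1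
        · exact Or.inl ⟨e', Or.inr h1, h2⟩
        · exact Or.inr h1
      · rw [hold a ha hne]
        rcases hlight a ha with ⟨e', h1, h2⟩ | h1
        · exact Or.inl ⟨e', Or.inl (Or.inl ⟨h1, h2 ▸ hne⟩), h2⟩
        · exact Or.inr h1

theorem TopDownInvariant.run
    (hinit : ∀ e ∈ (topDownInit split B S M α δ ω : TopDownState X k).queue, Good S e)
    (hpush : ∀ (T : DecTree X) (c d : ℕ), c ≤ 2 * M →
      (topDownPush split B S M ε α δ ω T c d = [] ∧ Light (T.leafData S c)) ∨
      ∃ e, topDownPush split B S M ε α δ ω T c d = [e] ∧ e.leaf = c ∧ Good (T.leafData S c) e)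
    (t : ℕ) (ht : t ≤ M) :
    TopDownInvariant Good Light S t (topDownRun split B h S M ε α δ ω t) := by
  induction t with
  | zero =>
    have hS : (DecTree.leaf 0 : DecTree X).leafData S 0 = S := by
      unfold DecTree.leafData
      simp [DecTree.route]
    refine ⟨{0}, by simp, by simp, ?_, ?_, ?_⟩
    · intro x
      simp [topDownRun, topDownInit, DecTree.route]
    · intro e he
      simp only [topDownRun, topDownInit, List.mem_singleton] at he
      subst he
      refine ⟨by simp, ?_⟩
      simp only [topDownRun, topDownInit]
      rw [hS]
      exact hinit _ (List.mem_singleton_self _)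
    · intro a ha
      rw [Finset.mem_singleton] at ha
      subst ha
      exact Or.inl ⟨_, List.mem_singleton_self _, rfl⟩
  | succ t ih =>
    exact (ih (by omega)).step fun T c d hc => hpush T c d (by omega)

end Run

section Analysis

variable {X : Type*} {k : ℕ}

/-- The priority of the entry `e` is, up to `3 * κ`, the weighted gain of its split and at least
that of every other split on the data `D`. -/
def AccurateEntry (h : Fin k → X → Bool) (N κ : ℝ) (D : Dataset X) (e : QueueEntry k) : Prop :=
  |N * e.priority - D.card * splitGain D (h e.split)| ≤ 3 * κ ∧
    ∀ j, D.card * splitGain D (h j) - 3 * κ ≤ N * e.priority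

variable {h : Fin k → X → Bool} {f : X → Bool} {γ : ℝ} {Δ : ℕ → ℝ} {S : Dataset X} {M : ℕ}
  {ε α δ τ κ : ℝ} {ω : Tape k}

theorem accurateEntry_topDownInit [NeZero k] (hM : 1 ≤ M) (hα : 0 < α) (hN : 0 < S.card)
    (hΔ : ∀ m, 0 ≤ Δ m ∧ m * Δ m ≤ 16 * (1 + Real.log m)) (hτ : 0 < τ)
    (hω : ∀ d, |ω (0, d)| ≤ τ) (hκ : κ = 128 * M * τ * (1 + Real.log S.card) / α) :
    ∀ e ∈ (topDownInit (rnmSplit h Δ) (fun _ => 1 / (M : ℝ)) S M α δ ω : TopDownState X k).queue,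
      AccurateEntry h S.card κ S e := by
  intro e he
  simp only [topDownInit, List.mem_singleton] at he
  have hM' : (0 : ℝ) < M := by exact_mod_cast hM
  have hN' : (0 : ℝ) < S.card := by exact_mod_cast hN
  have hl := Real.log_natCast_nonneg S.card
  obtain ⟨h1, h2⟩ := rnmSplit_spec (h := h) (Δ := Δ) (a := α / 2 * (1 / (M : ℝ)))
    (δ := δ / (2 * (2 * M + 1))) hN (by positivity) (hΔ _) fun j => hω (.split j)
  have hle : 32 * τ * (1 + Real.log S.card) / (α / 2 * (1 / (M : ℝ))) ≤ κ := by
    have : 32 * τ * (1 + Real.log S.card) / (α / 2 * (1 / (M : ℝ)))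
        = 64 * M * τ * (1 + Real.log S.card) / α := by
      field_simp; ring
    rw [this, hκ]
    gcongr
    norm_num
  have hκ0 : 0 ≤ κ := by rw [hκ]; positivity
  subst he
  constructor
  · simp only
    rw [← mul_sub, abs_mul, Nat.abs_cast]
    linarith
  · intro j
    simp only
    linarith [h2 j]

theorem topDownPush_spec [NeZero k] (hM : 1 ≤ M) (hα : 0 < α) (hN : 0 < S.card)
    (hΔ : ∀ m, 0 ≤ Δ m ∧ m * Δ m ≤ 16 * (1 + Real.log m)) (hτ : 0 < τ) (T : DecTree X) (c d : ℕ)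
    (hω : ∀ d, |ω (c, d)| ≤ τ) (hκ : κ = 128 * M * τ * (1 + Real.log S.card) / α)
    (hsmall : 8 * M * τ / α ≤ ε * S.card / M) :
    (topDownPush (rnmSplit h Δ) (fun _ => 1 / (M : ℝ)) S M ε α δ ω T c d = [] ∧
        ((T.leafData S c).card : ℝ) ≤ ε * S.card / M + 4 * M * τ / α) ∨
      ∃ e, topDownPush (rnmSplit h Δ) (fun _ => 1 / (M : ℝ)) S M ε α δ ω T c d = [e] ∧
        e.leaf = c ∧ AccurateEntry h S.card κ (T.leafData S c) e := by
  have hM' : (0 : ℝ) < M := by exact_mod_cast hM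
  have hN' : (0 : ℝ) < S.card := by exact_mod_cast hN
  have hl := Real.log_natCast_nonneg S.card
  set D := T.leafData S c with hD
  set w : ℝ := (D.card : ℝ) / S.card + 2 / (S.card * (α / 2 * (1 / (M : ℝ)))) * ω (c, .weight)
    with hw
  set ν : ℝ := 4 * M * τ / α with hν
  have hν0 : 0 < ν := by positivity
  have hNw : |S.card * w - D.card| ≤ ν := by
    have : S.card * w - D.card = 4 * M / α * ω (c, .weight) := by
      rw [hw]; field_simp; ring
    rw [this, abs_mul, abs_of_pos (by positivity), hν]
    calc 4 * M / α * |ω (c, .weight)| ≤ 4 * M / α * τ := by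
          gcongr
          exact hω _
      _ = 4 * M * τ / α := by ring
  have h2ν : 2 * ν ≤ ε * S.card / M := by
    refine le_trans (le_of_eq ?_) hsmall
    rw [hν]; ring
  unfold topDownPush
  simp only
  rw [← hD, ← hw]
  split_ifs with hif
  · right
    refine ⟨_, rfl, rfl, ?_⟩
    have hNw2 : ε * S.card / M ≤ S.card * w := by
      have := mul_le_mul_of_nonneg_left hif hN'.le
      calc ε * S.card / M = S.card * (ε / M) := by ring
        _ ≤ _ := this
    have hn : ν ≤ D.card := by linarith [(abs_le.mp hNw).2]
    have hn0 : (0 : ℝ) < D.card := hν0.trans_le hn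
    have hDS : (D.card : ℝ) ≤ S.card := by
      exact_mod_cast Multiset.card_le_card (Multiset.filter_le _ _)
    have hlog : Real.log D.card ≤ Real.log S.card := Real.log_le_log hn0 hDS
    obtain ⟨h1, h2⟩ := rnmSplit_spec (h := h) (Δ := Δ) (D := D) (a := α / 2 * (1 / (M : ℝ)) / 2)
      (δ := δ / (2 * (2 * M + 1))) (by exact_mod_cast hn0) (by positivity) (hΔ _)
      fun j => hω (.split j)
    set r := rnmSplit h Δ D (α / 2 * (1 / (M : ℝ)) / 2) (δ / (2 * (2 * M + 1)))
      fun j => ω (c, .split j) with hr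
    have hle : 32 * τ * (1 + Real.log D.card) / (α / 2 * (1 / (M : ℝ)) / 2) ≤ κ := by
      have : 32 * τ * (1 + Real.log D.card) / (α / 2 * (1 / (M : ℝ)) / 2)
          = 128 * M * τ * (1 + Real.log D.card) / α := by
        field_simp; ring
      rw [this, hκ]
      gcongr
    have hνκ : ν ≤ κ := by
      rw [hκ, hν]
      have h0 : (0 : ℝ) ≤ M * τ := by positivity
      rw [div_le_div_iff_of_pos_right hα]
      nlinarith [mul_nonneg h0 hl]
    have hJ := abs_card_mul_splitGain_le D (h r.1)
    have h3 : D.card * |r.2| ≤ D.card + κ := by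
      calc D.card * |r.2| = |D.card * splitGain D (h r.1)
            + D.card * (r.2 - splitGain D (h r.1))| := by
            rw [← mul_add, add_sub_cancel, abs_mul, Nat.abs_cast]
        _ ≤ |D.card * splitGain D (h r.1)| + |D.card * (r.2 - splitGain D (h r.1))| :=
            abs_add_le _ _
        _ ≤ D.card + κ := by
            rw [abs_mul (D.card : ℝ) (r.2 - _), Nat.abs_cast]
            linarith
    have h4 : ν * |r.2| ≤ 2 * κ := by
      refine le_of_mul_le_mul_left ?_ hn0
      calc D.card * (ν * |r.2|) = ν * (D.card * |r.2|) := by ring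
        _ ≤ ν * (D.card + κ) := mul_le_mul_of_nonneg_left h3 hν0.le
        _ = ν * D.card + ν * κ := by ring
        _ ≤ κ * D.card + D.card * κ := by
            refine add_le_add (mul_le_mul_of_nonneg_right hνκ hn0.le)
              (mul_le_mul_of_nonneg_right hn (hν0.le.trans hνκ))
        _ = D.card * (2 * κ) := by ring
    have h5 : |S.card * (w * r.2) - D.card * r.2| ≤ 2 * κ := by
      rw [← mul_assoc, ← sub_mul, abs_mul]
      exact (mul_le_mul_of_nonneg_right hNw (abs_nonneg _)).trans h4
    have h6 : |D.card * r.2 - D.card * splitGain D (h r.1)| ≤ κ := by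
      rw [← mul_sub, abs_mul, Nat.abs_cast]
      exact h1.trans hle
    constructor
    · simp only
      rw [abs_le] at h5 h6 ⊢
      constructor <;> linarith
    · intro j
      simp only
      linarith [h2 j, (abs_le.mp h5).1]
  · left
    refine ⟨rfl, ?_⟩
    have : S.card * w ≤ ε * S.card / M := by
      have := mul_le_mul_of_nonneg_left (not_le.mp hif).le hN'.le
      calc S.card * w ≤ S.card * (ε / M) := this
        _ = _ := by ring
    linarith [(abs_le.mp hNw).1]

/-- The number of training errors of the tree with the best possible labels at its leaves. -/
def totalMinority (S : Dataset X) (m : ℕ) (T : DecTree X) : ℝ :=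
  ∑ c ∈ Finset.range m, (minority (T.leafData S c) : ℝ)

/-- The total label entropy of the leaves of a tree. -/
noncomputable def totalEntropy (S : Dataset X) (m : ℕ) (T : DecTree X) : ℝ :=
  ∑ c ∈ Finset.range m, dataEntropy (T.leafData S c)

theorem totalMinority_step_le {Good : Dataset X → QueueEntry k → Prop}
    {Light : Dataset X → Prop} {t : ℕ} {s : TopDownState X k} {split : SplitRoutine X k}
    {B : ℕ → ℝ} (hs : TopDownInvariant Good Light S t s) (ht : t < M) :
    totalMinority S (2 * M + 1) (topDownStep split B h S M ε α δ ω t s).tree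
      ≤ totalMinority S (2 * M + 1) s.tree := by
  by_cases hq : s.queue = []
  · rw [topDownStep_of_queue_nil hq]
  · obtain ⟨e, he, -, hmax⟩ := exists_queue_argmax hq
    rw [topDownStep_tree hmax]
    have hrt := hs.route_lt
    obtain ⟨A, -, hlt, -, hgood, -⟩ := hs
    have heℓ := hlt _ (hgood e he).1
    have hsum := DecTree.sum_leafData_splitLeaf (T := s.tree) (S := S) (ℓ := e.leaf)
      (c₀ := 2 * t + 1) (c₁ := 2 * t + 2) (g := h e.split) (m := 2 * M + 1)
      (fun D => (minority D : ℝ)) (by simp [minority_zero]) (by omega) (by omega) (by omega)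
      (fun x => by have := hrt x; omega) (fun x => by have := hrt x; omega) (by omega)
      (by omega) (by omega)
    have hch : (minority (child (s.tree.leafData S e.leaf) (h e.split) false) : ℝ)
        + minority (child (s.tree.leafData S e.leaf) (h e.split) true)
          ≤ minority (s.tree.leafData S e.leaf) := by
      exact_mod_cast minority_child_add_le _ _
    unfold totalMinority
    linarith

/-- While the error is large, a step decreases the total label entropy. -/
theorem totalEntropy_step_le {t : ℕ} {s : TopDownState X k} {b : ℝ} {split : SplitRoutine X k}
    {B : ℕ → ℝ} (hw : WeakLearning h f γ) (hγ : 0 < γ) (hf : ∀ z ∈ S, z.2 = f z.1) (hε : 0 < ε)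
    (hN : 0 < S.card)
    (hs : TopDownInvariant (AccurateEntry h S.card κ) (fun D => (D.card : ℝ) ≤ b) S t s)
    (ht : t < M) (hb : M * b ≤ 101 / 100 * (ε * S.card)) (hκ : 100 * M * κ ≤ γ ^ 2 * (ε * S.card))
    (hE : 7 / 8 * (ε * S.card) ≤ totalMinority S (2 * M + 1) s.tree) :
    totalEntropy S (2 * M + 1) (topDownStep split B h S M ε α δ ω t s).tree
      ≤ totalEntropy S (2 * M + 1) s.tree
        - γ ^ 2 / 20 * totalMinority S (2 * M + 1) s.tree / (t + 1) := by
  have hrt := hs.route_lt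
  obtain ⟨A, hcard, hlt, hroute, hgood, hlight⟩ := hs
  set E := totalMinority S (2 * M + 1) s.tree with hEdef
  have hM' : (0 : ℝ) < M := by exact_mod_cast (Nat.zero_le t).trans_lt ht
  have hεN : 0 < ε * S.card := mul_pos hε (by exact_mod_cast hN)
  have hE0 : 0 < E := by linarith
  have ht0 : (0 : ℝ) < t + 1 := by positivity
  have htM : (t : ℝ) + 1 ≤ M := by exact_mod_cast ht
  have hEA : E = ∑ c ∈ A, (minority (s.tree.leafData S c) : ℝ) := by
    rw [hEdef, totalMinority]
    symm
    refine Finset.sum_subset (fun a ha => ?_) fun c _ hc => ?_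
    · have := hlt a ha
      rw [Finset.mem_range]
      omega
    · have hne : ∀ x, s.tree.route x ≠ c := by
        rintro x rfl
        exact hc (hroute x)
      rw [DecTree.leafData_eq_zero hne, minority_zero, Nat.cast_zero]
  obtain ⟨e', he', hbig⟩ : ∃ e' ∈ s.queue,
      2 / 5 * E / (t + 1) ≤ minority (s.tree.leafData S e'.leaf) := by
    by_contra! hcon
    have hbound : ∀ a ∈ A, (minority (s.tree.leafData S a) : ℝ)
        ≤ max (2 / 5 * E / (t + 1)) (2 / 5 * E / (t + 1) + b / 2) := by
      intro a ha
      rcases hlight a ha with ⟨e, he, rfl⟩ | hla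
      · exact (hcon e he).le.trans (le_max_left _ _)
      · refine le_trans ?_ (le_max_right _ _)
        have : (2 : ℝ) * minority (s.tree.leafData S a) ≤ (s.tree.leafData S a).card := by
          exact_mod_cast two_mul_minority_le _
        have : 0 ≤ 2 / 5 * E / (t + 1) := by positivity
        linarith
    have hm0 : 0 ≤ max (2 / 5 * E / (t + 1)) (2 / 5 * E / (t + 1) + b / 2) :=
      le_trans (by positivity) (le_max_left _ _)
    have h1 := Finset.sum_le_card_nsmul A _ _ hbound
    rw [← hEA, nsmul_eq_mul] at h1
    have h2 : E ≤ (t + 1) * max (2 / 5 * E / (t + 1)) (2 / 5 * E / (t + 1) + b / 2) :=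
      h1.trans (mul_le_mul_of_nonneg_right (by exact_mod_cast hcard) hm0)
    have h3 : (t + 1) * (2 / 5 * E / (t + 1)) = 2 / 5 * E := by field_simp
    rcases max_choice (2 / 5 * E / (t + 1)) (2 / 5 * E / (t + 1) + b / 2) with hm | hm
    · rw [hm, h3] at h2
      linarith
    · rw [hm, mul_add, h3] at h2
      have h4 : (t + 1) * (b / 2) ≤ max 0 (M * b / 2) := by
        rcases le_total 0 b with hb0 | hb0
        · refine le_trans ?_ (le_max_right _ _)
          nlinarith
        · refine le_trans ?_ (le_max_left _ _)
          nlinarith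
      have h5 : max 0 (M * b / 2) ≤ 101 / 200 * (ε * S.card) := max_le (by positivity) (by linarith)
      linarith
  set D' := s.tree.leafData S e'.leaf with hD'
  have hm0 : (0 : ℝ) < minority D' := lt_of_lt_of_le (by positivity) hbig
  obtain ⟨j, hj⟩ := hw.exists_gain hγ (D := D')
    (fun z hz => hf z (Multiset.mem_of_le (Multiset.filter_le _ _) hz)) (by exact_mod_cast hm0)
  obtain ⟨e, he, hmaxe, hmax⟩ := exists_queue_argmax (List.ne_nil_of_mem he')
  have hpri : (S.card : ℝ) * e'.priority ≤ S.card * e.priority :=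
    mul_le_mul_of_nonneg_left (hmaxe e' he') (Nat.cast_nonneg _)
  have hg' := (hgood e' he').2.2 j
  have hg := (abs_le.mp (hgood e he).2.1).2
  rw [topDownStep_tree hmax]
  set D := s.tree.leafData S e.leaf with hD
  have hmin : 7 / 20 * (ε * S.card) ≤ M * minority D' := by
    have h1 := (div_le_iff₀ ht0).mp hbig
    have h2 : (minority D' : ℝ) * (t + 1) ≤ minority D' * M :=
      mul_le_mul_of_nonneg_left htM hm0.le
    linarith
  have h6κ : 6 * κ ≤ γ ^ 2 / 4 * minority D' := by
    refine le_of_mul_le_mul_left ?_ hM'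
    have h1 := mul_le_mul_of_nonneg_left hmin (sq_nonneg γ)
    have h2 : 0 ≤ γ ^ 2 * (ε * S.card) := by positivity
    nlinarith
  have hgain : γ ^ 2 / 10 * E / (t + 1) ≤ D.card * splitGain D (h e.split) := by
    have h1 : γ ^ 2 / 10 * E / (t + 1) ≤ γ ^ 2 / 4 * minority D' := by
      calc γ ^ 2 / 10 * E / (t + 1) = γ ^ 2 / 4 * (2 / 5 * E / (t + 1)) := by ring
        _ ≤ _ := mul_le_mul_of_nonneg_left hbig (by positivity)
    rw [← hD'] at hg'
    linarith
  have heℓ := hlt _ (hgood e he).1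
  have hsum := DecTree.sum_leafData_splitLeaf (T := s.tree) (S := S) (ℓ := e.leaf)
    (c₀ := 2 * t + 1) (c₁ := 2 * t + 2) (g := h e.split) (m := 2 * M + 1)
    dataEntropy dataEntropy_zero (by omega) (by omega) (by omega)
    (fun x => by have := hrt x; omega) (fun x => by have := hrt x; omega) (by omega)
    (by omega) (by omega)
  have hJ := card_mul_splitGain D (h e.split)
  rw [← hD] at hsum
  have hlog : 1 / 2 ≤ Real.log 2 := by have := Real.log_two_gt_d9; linarith
  have h0 : 0 ≤ γ ^ 2 / 10 * E / (t + 1) := by positivity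
  have hfin : γ ^ 2 / 20 * E / (t + 1) ≤ D.card * splitGain D (h e.split) * Real.log 2 := by
    calc γ ^ 2 / 20 * E / (t + 1) = γ ^ 2 / 10 * E / (t + 1) * (1 / 2) := by ring
      _ ≤ _ := mul_le_mul hgain hlog (by norm_num) (h0.trans hgain)
  unfold totalEntropy
  linarith

end Analysis

theorem le_mul_exp_of_step_le {P : ℕ → ℝ} {β : ℝ} {t : ℕ} (hβ : 0 ≤ β) (ht : 1 ≤ t)
    (hP : ∀ s ≤ t, 0 ≤ P s) (hstep : ∀ s < t, P (s + 1) ≤ P s - β * P s / (s + 1)) :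
    P t ≤ P 0 * Real.exp (-(β * Real.log t)) := by
  have key : ∀ s ≤ t, P s ≤ P 0 * Real.exp (-(β * (harmonic s : ℝ))) := by
    intro s
    induction s with
    | zero => simp
    | succ s ih =>
      intro hs
      have h1 := ih (by omega)
      have h2 := hstep s (by omega)
      have h3 : 1 - β / (s + 1) ≤ Real.exp (-(β / (s + 1))) := by
        have := Real.add_one_le_exp (-(β / ((s : ℝ) + 1)))
        linarith
      calc P (s + 1) ≤ P s * (1 - β / (s + 1)) := by
            refine h2.trans (le_of_eq ?_)
            ring
        _ ≤ P s * Real.exp (-(β / (s + 1))) := mul_le_mul_of_nonneg_left h3 (hP s (by omega))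
        _ ≤ P 0 * Real.exp (-(β * (harmonic s : ℝ))) * Real.exp (-(β / (s + 1))) :=
            mul_le_mul_of_nonneg_right h1 (Real.exp_pos _).le
        _ = P 0 * Real.exp (-(β * (harmonic (s + 1) : ℝ))) := by
            rw [mul_assoc, ← Real.exp_add, harmonic_succ]
            push_cast
            congr 2
            rw [div_eq_mul_inv]
            ring
  refine (key t le_rfl).trans (mul_le_mul_of_nonneg_left ?_ (hP 0 (Nat.zero_le t)))
  refine Real.exp_le_exp.mpr (neg_le_neg (mul_le_mul_of_nonneg_left ?_ hβ))
  refine le_trans (Real.log_le_log (by exact_mod_cast ht) ?_) (log_add_one_le_harmonic t)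
  push_cast
  linarith

theorem quarter_le_log_one_div {ε : ℝ} (hε : 0 < ε) (hε1 : ε ≤ 3 / 4) :
    1 / 4 ≤ Real.log (1 / ε) := by
  have h := Real.one_sub_inv_le_log_of_pos (one_div_pos.mpr hε)
  rw [one_div ε, inv_inv, ← one_div] at h
  linarith

/-- The recursion for the total entropy bounds the number of steps. -/
theorem log_le_of_entropy_decay {P E : ℕ → ℝ} {N ε γ : ℝ} {t : ℕ} (hN : 0 < N) (hε : 0 < ε)
    (hε1 : ε ≤ 3 / 4) (ht : 1 ≤ t) (hP : ∀ s, 0 ≤ P s)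
    (hPE : ∀ s < t, P s ≤ 9 * Real.log (1 / ε) * E s)
    (hstep : ∀ s < t, P (s + 1) ≤ P s - γ ^ 2 / 20 * E s / (s + 1))
    (hP0 : P 0 ≤ N * Real.log 2) (hPt : 7 / 8 * (ε * N) * Real.log 2 ≤ P t) :
    γ ^ 2 / (180 * Real.log (1 / ε)) * Real.log t ≤ 2 * Real.log (1 / ε) := by
  have hΛ4 := quarter_le_log_one_div hε hε1
  have h2 : Real.log (1 / ε) = -Real.log ε := by rw [one_div, Real.log_inv]
  generalize Real.log (1 / ε) = Λ at *
  have hΛ : 0 < Λ := by linarith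
  have hβ : 0 ≤ γ ^ 2 / (180 * Λ) := by positivity
  have hPstep : ∀ s < t, P (s + 1) ≤ P s - γ ^ 2 / (180 * Λ) * P s / (s + 1) := by
    intro s hs
    refine (hstep s hs).trans (sub_le_sub_left ?_ _)
    have h3 : γ ^ 2 / (180 * Λ) * P s ≤ γ ^ 2 / 20 * E s := by
      calc γ ^ 2 / (180 * Λ) * P s ≤ γ ^ 2 / (180 * Λ) * (9 * Λ * E s) :=
            mul_le_mul_of_nonneg_left (hPE s hs) hβ
        _ = γ ^ 2 / 20 * E s := by
            field_simp
            ring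
    exact div_le_div_of_nonneg_right h3 (by positivity)
  have hdecay := le_mul_exp_of_step_le hβ ht (fun s _ => hP s) hPstep
  have hlog2 : 0 < Real.log 2 := Real.log_pos one_lt_two
  have hle : 7 / 8 * ε ≤ Real.exp (-(γ ^ 2 / (180 * Λ) * Real.log t)) := by
    have h1 := mul_le_mul_of_nonneg_right hP0
      (Real.exp_pos (-(γ ^ 2 / (180 * Λ) * Real.log t))).le
    refine le_of_mul_le_mul_left ?_ (mul_pos hN hlog2)
    linarith
  have h1 := Real.log_le_log (by positivity) hle
  rw [Real.log_exp, Real.log_mul (by norm_num) hε.ne'] at h1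
  have h3 := Real.one_sub_inv_le_log_of_pos (x := (7 / 8 : ℝ)) (by norm_num)
  norm_num at h3
  linarith

section Final

variable {X : Type*} {k : ℕ} {S : Dataset X} {M : ℕ} {ε α δ τ κ γ : ℝ} {ω : Tape k}

theorem countP_classifier_le {split : SplitRoutine X k} {B : ℕ → ℝ} {h : Fin k → X → Bool}
    {t m : ℕ} (hα : 0 < α) (hω : ∀ c < m, ∀ d, |ω (c, d)| ≤ τ)
    (hroute : ∀ x, (topDownRun split B h S M ε α δ ω t).tree.route x < m) :
    (S.countP fun z => topDownClassifier split B h S M ε α δ ω t z.1 ≠ z.2 : ℝ)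
      ≤ totalMinority S m (topDownRun split B h S M ε α δ ω t).tree + m * (8 * τ / α) := by
  rw [← DecTree.sum_countP_leafData hroute]
  push_cast
  have hm : (m : ℝ) * (8 * τ / α) = ∑ c ∈ Finset.range m, 8 * τ / α := by simp
  rw [hm, totalMinority, ← Finset.sum_add_distrib]
  refine Finset.sum_le_sum fun c hc => ?_
  refine le_trans (le_of_eq ?_)
    (countP_noisyLabel_le hα fun y => hω c (Finset.mem_range.mp hc) (.label y))
  congr 1
  refine Multiset.countP_congr rfl fun z hz => ?_
  have hz' : (topDownRun split B h S M ε α δ ω t).tree.route z.1 = c :=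
    (Multiset.mem_filter.mp hz).2
  simp only [topDownClassifier, hz']

theorem totalEntropy_nonneg (m : ℕ) (T : DecTree X) : 0 ≤ totalEntropy S m T :=
  Finset.sum_nonneg fun _ _ => dataEntropy_nonneg _

theorem sum_card_leafData_cast {m : ℕ} {T : DecTree X} (hT : ∀ x, T.route x < m) :
    ∑ c ∈ Finset.range m, ((T.leafData S c).card : ℝ) = S.card := by
  exact_mod_cast DecTree.sum_card_leafData hT

theorem totalEntropy_le {m : ℕ} {T : DecTree X} (hT : ∀ x, T.route x < m) :
    totalEntropy S m T ≤ S.card * Real.log 2 := by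
  rw [← sum_card_leafData_cast hT, Finset.sum_mul]
  exact Finset.sum_le_sum fun _ _ => dataEntropy_le _

theorem totalMinority_mul_log_two_le (m : ℕ) (T : DecTree X) :
    totalMinority S m T * Real.log 2 ≤ totalEntropy S m T := by
  rw [totalMinority, Finset.sum_mul]
  exact Finset.sum_le_sum fun _ _ => minority_mul_log_two_le _

theorem two_mul_totalMinority_le {m : ℕ} {T : DecTree X} (hT : ∀ x, T.route x < m) :
    2 * totalMinority S m T ≤ S.card := by
  rw [← sum_card_leafData_cast hT, totalMinority, Finset.mul_sum]
  exact Finset.sum_le_sum fun _ _ => by exact_mod_cast two_mul_minority_le _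

theorem totalEntropy_le_totalMinority {m : ℕ} {T : DecTree X} (hT : ∀ x, T.route x < m)
    (hε : 0 < ε) (hε1 : ε ≤ 3 / 4) (hE : 7 / 8 * (ε * S.card) ≤ totalMinority S m T) :
    totalEntropy S m T ≤ 9 * Real.log (1 / ε) * totalMinority S m T := by
  have h1 : totalEntropy S m T
      ≤ totalMinority S m T * -Real.log (ε / 2) + S.card * -Real.log (1 - ε / 2) := by
    rw [← sum_card_leafData_cast hT, totalMinority, Finset.sum_mul, Finset.sum_mul,
      ← Finset.sum_add_distrib]
    exact Finset.sum_le_sum fun _ _ =>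
      dataEntropy_le_minority _ (by linarith) (by linarith)
  have h2 : -Real.log (ε / 2) = Real.log (1 / ε) + Real.log 2 := by
    rw [Real.log_div hε.ne' two_ne_zero, one_div, Real.log_inv]
    ring
  have h3 : -Real.log (1 - ε / 2) ≤ ε := by
    have hpos : 0 < 1 - ε / 2 := by linarith
    have h := Real.one_sub_inv_le_log_of_pos hpos
    have : (1 - ε / 2)⁻¹ ≤ 1 + ε := by
      rw [inv_le_comm₀ hpos (by linarith), inv_eq_one_div, div_le_iff₀ (by linarith)]
      nlinarith
    linarith
  have h4 := quarter_le_log_one_div hε hε1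
  have h5 : (S.card : ℝ) * -Real.log (1 - ε / 2) ≤ S.card * ε :=
    mul_le_mul_of_nonneg_left h3 (Nat.cast_nonneg _)
  have h6 : (S.card : ℝ) * ε ≤ 8 / 7 * totalMinority S m T := by linarith
  have h7 : Real.log 2 ≤ 0.7 := by have := Real.log_two_lt_d9; linarith
  have hE0 : 0 ≤ totalMinority S m T := le_trans (by positivity) hE
  rw [h2] at h1
  nlinarith [mul_nonneg hE0 (sub_nonneg.mpr h4), mul_nonneg hE0 (sub_nonneg.mpr h7)]

/-- If all the random draws are small, then DP-TopDown reaches a small training error. -/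
theorem trainingError_topDown_le [NeZero k] {h : Fin k → X → Bool} {f : X → Bool} {Δ : ℕ → ℝ}
    {C : ℝ} (hC : 400 ≤ C) (hw : WeakLearning h f γ) (hγ : 0 < γ) (hf : ∀ z ∈ S, z.2 = f z.1)
    (hN : 0 < S.card) (hM : 1 ≤ M) (hε : 0 < ε) (hα : 0 < α) (hτ : 0 < τ)
    (hΔ : ∀ m, 0 ≤ Δ m ∧ m * Δ m ≤ 16 * (1 + Real.log m))
    (hω : ∀ c < 2 * M + 1, ∀ d, |ω (c, d)| ≤ τ)
    (hsize : 100 * M * (128 * M * τ * (1 + Real.log S.card) / α) ≤ γ ^ 2 * (ε * S.card))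
    {t : ℕ} (htM : t ≤ M) (ht : (1 / ε) ^ (C * Real.log (1 / ε) / γ ^ 2) ≤ (t : ℝ)) :
    trainingError S
      (topDownClassifier (rnmSplit h Δ) (fun _ => 1 / (M : ℝ)) h S M ε α δ ω t) ≤ ε := by
  obtain ⟨x, -⟩ := Multiset.card_pos_iff_exists_mem.mp hN
  have hγ1 := hw.le_half x.1
  have hM' : (1 : ℝ) ≤ M := by exact_mod_cast hM
  have hM0 : (0 : ℝ) < M := by linarith
  have hN' : (0 : ℝ) < S.card := by exact_mod_cast hN
  have hl := Real.log_natCast_nonneg S.card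
  have hεN : 0 < ε * S.card := mul_pos hε hN'
  obtain ⟨κ, hκ⟩ : ∃ κ, κ = 128 * M * τ * (1 + Real.log S.card) / α := ⟨_, rfl⟩
  rw [← hκ] at hsize
  have hντ : 128 * (M * τ / α) ≤ κ := by
    have : κ = 128 * (M * τ / α) * (1 + Real.log S.card) := by rw [hκ]; ring
    rw [this]
    have : 0 ≤ 128 * (M * τ / α) := by positivity
    nlinarith
  have hκ0 : 0 ≤ κ := le_trans (by positivity) hντ
  have hκs : 400 * (M * κ) ≤ ε * S.card := by
    have : γ ^ 2 ≤ 1 / 4 := by nlinarith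
    nlinarith
  have hκM : κ ≤ M * κ := by nlinarith
  have hsmall : 8 * M * τ / α ≤ ε * S.card / M := by
    have h1 : 8 * M * τ / α = 8 * (M * τ / α) := by ring
    rw [h1, le_div_iff₀ hM0]
    nlinarith
  set run := topDownRun (rnmSplit h Δ) (fun _ => 1 / (M : ℝ)) h S M ε α δ ω with hrun
  have hinv : ∀ s ≤ M, TopDownInvariant (AccurateEntry h S.card κ)
      (fun D => (D.card : ℝ) ≤ ε * S.card / M + 4 * M * τ / α) S s (run s) := by
    intro s hs
    refine TopDownInvariant.run (accurateEntry_topDownInit hM hα hN hΔ hτ (hω 0 (by omega)) hκ)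
      (fun T c d hc => ?_) s hs
    exact topDownPush_spec hM hα hN hΔ hτ T c d (hω c (by omega)) hκ hsmall
  have hroute : ∀ s ≤ M, ∀ x, (run s).tree.route x < 2 * M + 1 := by
    intro s hs x
    have := (hinv s hs).route_lt x
    omega
  set E : ℕ → ℝ := fun s => totalMinority S (2 * M + 1) (run s).tree with hEdef
  set P : ℕ → ℝ := fun s => totalEntropy S (2 * M + 1) (run s).tree with hPdef
  have herr := countP_classifier_le (split := rnmSplit h Δ) (B := fun _ => 1 / (M : ℝ)) (h := h)
    (S := S) (M := M) (ε := ε) (δ := δ) hα hω (hroute t htM)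
  have hlabel : ((2 * M + 1 : ℕ) : ℝ) * (8 * τ / α) ≤ 1 / 8 * (ε * S.card) := by
    have h1 : ((2 * M + 1 : ℕ) : ℝ) * (8 * τ / α) ≤ 3 * M * (8 * τ / α) := by
      push_cast
      refine mul_le_mul_of_nonneg_right (by linarith) (by positivity)
    have h2 : 3 * M * (8 * τ / α) = 24 * (M * τ / α) := by ring
    linarith
  have herr' : (S.countP fun z => topDownClassifier (rnmSplit h Δ) (fun _ => 1 / (M : ℝ)) h S M ε α
      δ ω t z.1 ≠ z.2 : ℝ) ≤ E t + 1 / 8 * (ε * S.card) := by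
    refine herr.trans (add_le_add le_rfl hlabel)
  unfold trainingError
  rw [div_le_iff₀ hN']
  by_contra! hcon
  have hEt : 7 / 8 * (ε * S.card) ≤ E t := by linarith
  have hhalf : 2 * E t ≤ S.card := two_mul_totalMinority_le (hroute t htM)
  have hε34 : ε ≤ 3 / 4 := by
    by_contra! h34
    nlinarith
  have hEmono : ∀ s < t, E (s + 1) ≤ E s := fun s hs =>
    totalMinority_step_le (hinv s (by omega)) (by omega)
  have hEs : ∀ s ≤ t, 7 / 8 * (ε * S.card) ≤ E s := by
    intro s hs
    induction hs using Nat.decreasingInduction with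
    | self => exact hEt
    | of_succ s hs ih => exact ih.trans (hEmono s hs)
  have hPstep : ∀ s < t, P (s + 1) ≤ P s - γ ^ 2 / 20 * E s / (s + 1) := by
    intro s hs
    refine totalEntropy_step_le hw hγ hf hε hN (hinv s (by omega)) (by omega) ?_ hsize
      (hEs s hs.le)
    have h2 : M * (ε * S.card / M + 4 * M * τ / α) = ε * S.card + 4 * (M * (M * τ / α)) := by
      field_simp
    rw [h2]
    nlinarith
  have hexp : Real.exp (C * Real.log (1 / ε) ^ 2 / γ ^ 2) ≤ t := by
    refine le_trans (le_of_eq ?_) ht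
    rw [Real.rpow_def_of_pos (by positivity)]
    congr 1
    ring
  have ht0 : (0 : ℝ) < t := (Real.exp_pos _).trans_le hexp
  have hlogt : C * Real.log (1 / ε) ^ 2 / γ ^ 2 ≤ Real.log t :=
    (Real.le_log_iff_exp_le ht0).mpr hexp
  have hPt : 7 / 8 * (ε * S.card) * Real.log 2 ≤ P t :=
    (mul_le_mul_of_nonneg_right hEt (Real.log_pos one_lt_two).le).trans
      (totalMinority_mul_log_two_le _ _)
  have hloge := log_le_of_entropy_decay hN' hε hε34 (by exact_mod_cast ht0)
    (fun s => totalEntropy_nonneg _ _)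
    (fun s hs => totalEntropy_le_totalMinority (hroute s (by omega)) hε hε34 (hEs s hs.le)) hPstep
    (totalEntropy_le (hroute 0 (by omega))) hPt
  have hΛ4 := quarter_le_log_one_div hε hε34
  generalize Real.log (1 / ε) = Λ at *
  have hfin : γ ^ 2 / (180 * Λ) * (C * Λ ^ 2 / γ ^ 2) ≤ 2 * Λ :=
    le_trans (mul_le_mul_of_nonneg_left hlogt (by positivity)) hloge
  have heq : γ ^ 2 / (180 * Λ) * (C * Λ ^ 2 / γ ^ 2) = C / 180 * Λ := by
    have : Λ ≠ 0 := by linarith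
    field_simp
  rw [heq] at hfin
  nlinarith

end Final

/-- The sample bound dominates the noise of the algorithm. -/
theorem mul_one_add_log_le_of_le {N Q E : ℝ} (hN : 0 < N) (hQ : 0 ≤ Q) (hE : Real.exp 1 ≤ E)
    (hQE : Q ≤ E ^ 3) (hsize : 2000000 * Real.log E ^ 2 * Q ≤ N) :
    51200 * Q * Real.log E * (1 + Real.log N) ≤ N := by
  have hE0 : 0 < E := (Real.exp_pos 1).trans_le hE
  have hL1 : 1 ≤ Real.log E := (Real.le_log_iff_exp_le hE0).mpr hE
  set L := Real.log E with hL
  have hLE : L ≤ E := (Real.log_le_sub_one_of_pos hE0).trans (by linarith)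
  have hB : (0 : ℝ) < 102400 * E ^ 4 := by positivity
  have h1 := Real.log_le_sub_one_of_pos (div_pos hN hB)
  rw [Real.log_div hN.ne' hB.ne', Real.log_mul (by norm_num) (by positivity), Real.log_pow] at h1
  have h2 : Real.log 102400 ≤ 12 := by
    rw [Real.log_le_iff_le_exp (by norm_num)]
    have : Real.exp 12 = Real.exp 1 ^ 12 := by rw [← Real.exp_nat_mul]; norm_num
    rw [this]
    have h3 : (2.7 : ℝ) ≤ Real.exp 1 := by have := Real.exp_one_gt_d9; linarith
    refine le_trans ?_ (pow_le_pow_left₀ (by norm_num) h3 12)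
    norm_num
  have h3 : 1 + Real.log N ≤ N / (102400 * E ^ 4) + 16 * L := by
    push_cast at h1
    linarith
  have hQL : Q * L ≤ E ^ 4 := by
    calc Q * L ≤ E ^ 3 * E := mul_le_mul hQE hLE (by linarith) (by positivity)
      _ = E ^ 4 := by ring
  have h4 : 51200 * (Q * L) * (N / (102400 * E ^ 4)) ≤ N / 2 := by
    calc 51200 * (Q * L) * (N / (102400 * E ^ 4)) ≤ 51200 * E ^ 4 * (N / (102400 * E ^ 4)) := by
          gcongr
      _ = N / 2 := by field_simp; norm_num
  have hQL0 : 0 ≤ Q * L := mul_nonneg hQ (by linarith)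
  have h5 : 0 ≤ Q * L ^ 2 := by positivity
  calc 51200 * Q * L * (1 + Real.log N) = 51200 * (Q * L) * (1 + Real.log N) := by ring
    _ ≤ 51200 * (Q * L) * (N / (102400 * E ^ 4) + 16 * L) :=
        mul_le_mul_of_nonneg_left h3 (by positivity)
    _ = 51200 * (Q * L) * (N / (102400 * E ^ 4)) + 819200 * (Q * L ^ 2) := by ring
    _ ≤ N := by linarith

/-- Bounds for the argument `E` of the logarithm in the sample bound. -/
theorem sample_parameter_bounds {k M ε α δ γ E : ℝ} (hk : 1 ≤ k) (hM : 1 ≤ M) (hε : 0 < ε)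
    (hε1 : ε ≤ 1) (hα : 0 < α) (hδ : 0 < δ) (hδ1 : δ ≤ 1) (hγ : 0 < γ) (hγ1 : γ ≤ 1 / 2)
    (hE : E = Real.exp 1 * (k * M / (ε * δ * γ)) * (1 + 1 / α)) :
    Real.exp 1 ≤ E ∧ M ^ 2 / (γ ^ 2 * ε * α) ≤ E ^ 3 ∧ 24 * (k * M / δ) ≤ E ^ 2 := by
  have he : 2.7 ≤ Real.exp 1 := by have := Real.exp_one_gt_d9; linarith
  have hα1 : 0 < 1 / α := by positivity
  have hkM : 1 ≤ k * M := one_le_mul_of_one_le_of_one_le hk hM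
  have hεδγ : ε * δ * γ ≤ 1 := mul_le_one₀ (mul_le_one₀ hε1 hδ.le hδ1) hγ.le (by linarith)
  have hEge : ∀ y : ℝ, 0 ≤ y → y * (ε * δ * γ) ≤ k * M → Real.exp 1 * y * (1 + 1 / α) ≤ E := by
    intro y hy hyb
    rw [hE]
    have : y ≤ k * M / (ε * δ * γ) := (le_div_iff₀ (by positivity)).mpr hyb
    gcongr
  have hEge' : ∀ y : ℝ, 0 ≤ y → y * (ε * δ * γ) ≤ k * M → Real.exp 1 * y ≤ E := by
    intro y hy hyb
    refine le_trans (le_mul_of_one_le_right (by positivity) (by linarith)) (hEge y hy hyb)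
  have hE1 : Real.exp 1 ≤ E := by
    have h1 := hEge' 1 zero_le_one (by linarith)
    linarith
  have hEα : 1 / α ≤ E := by
    have h1 := hEge 1 zero_le_one (by linarith)
    nlinarith
  have hEk : Real.exp 1 * (2 * (k * M / δ)) ≤ E := by
    refine hEge' _ (by positivity) ?_
    have h2 : 2 * (k * M / δ) * (ε * δ * γ) = k * M * (ε * (2 * γ)) := by field_simp
    rw [h2]
    exact mul_le_of_le_one_right (by linarith) (mul_le_one₀ hε1 (by positivity) (by linarith))
  have hEM : M / (ε * γ) ≤ E := by
    refine le_trans (le_mul_of_one_le_left (by positivity) (by linarith))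
      (hEge' (M / (ε * γ)) (by positivity) ?_)
    have h2 : M / (ε * γ) * (ε * δ * γ) = δ * M := by field_simp
    rw [h2]
    exact mul_le_mul_of_nonneg_right (hδ1.trans hk) (by linarith)
  refine ⟨hE1, ?_, ?_⟩
  · have hQ0 : 0 ≤ M ^ 2 / (γ ^ 2 * ε * α) := by positivity
    calc M ^ 2 / (γ ^ 2 * ε * α) ≤ M ^ 2 / (γ ^ 2 * ε * α) * (1 / ε) :=
          le_mul_of_one_le_right hQ0 (by rwa [one_le_div hε])
      _ = (M / (ε * γ)) ^ 2 * (1 / α) := by field_simp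
      _ ≤ E ^ 2 * E := by gcongr
      _ = E ^ 3 := by ring
  · have h1 : 1 ≤ k * M / δ := by
      rw [one_le_div hδ]
      linarith
    have h2 : (5.4 * (k * M / δ)) ^ 2 ≤ E ^ 2 := by
      refine pow_le_pow_left₀ (by positivity) (le_trans ?_ hEk) 2
      nlinarith
    refine le_trans ?_ h2
    nlinarith

theorem mainTheorem5 :
    ∃ (C : ℝ) (p : ℕ), 0 < C ∧
      ∀ (X : Type*) (f : X → Bool) (k : ℕ) [NeZero k] (h : Fin k → X → Bool) (γ : ℝ),
        0 < γ → WeakLearning h f γ →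
      ∀ Δ : ℕ → ℝ, (Δ = gainSensitivity h ∨ Δ = gainSensitivityBound) →
      ∀ (M : ℕ) (ε α δ : ℝ), 1 ≤ M → 0 < ε → ε ≤ 1 → 0 < α → 0 < δ → δ ≤ 1 →
      ∀ S : Dataset X, (∀ z ∈ S, z.2 = f z.1) →
        C * Real.log (Real.exp 1 * (k * M / (ε * δ * γ)) * (1 + 1 / α)) ^ p
            * ((M : ℝ) ^ 3 / (ε ^ 2 * γ ^ 2 * α)) ≤ (S.card : ℝ) →
        tapeLaw k {ω | ∃ t : ℕ, t ≤ M ∧ (1 / ε) ^ (C * Real.log (1 / ε) / γ ^ 2) ≤ (t : ℝ) ∧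
            ε < trainingError S
              (topDownClassifier (rnmSplit h Δ) (fun _ => 1 / (M : ℝ)) h S M ε α δ ω t)}
          ≤ ENNReal.ofReal δ := by
  refine ⟨2000000, 2, by norm_num, ?_⟩
  intro X f k _ h γ hγ hw Δ hΔ M ε α δ hM hε hε1 hα hδ hδ1 S hf hsize
  rcases Nat.eq_zero_or_pos S.card with hN | hN
  · have hempty : ∀ g : X → Bool, trainingError S g = 0 := by
      intro g
      simp [trainingError, hN]
    have : {ω : Tape k | ∃ t : ℕ, t ≤ M ∧
        (1 / ε) ^ (2000000 * Real.log (1 / ε) / γ ^ 2) ≤ (t : ℝ) ∧ ε < trainingError S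
          (topDownClassifier (rnmSplit h Δ) (fun _ => 1 / (M : ℝ)) h S M ε α δ ω t)} = ∅ := by
      ext ω
      simp only [hempty, Set.mem_ofPred_eq, Set.mem_empty_iff_false, iff_false]
      rintro ⟨t, -, -, ht⟩
      linarith
    rw [this, measure_empty]
    exact zero_le
  obtain ⟨x, -⟩ := Multiset.card_pos_iff_exists_mem.mp hN
  have hγ1 := hw.le_half x.1
  have hk : (1 : ℝ) ≤ k := by exact_mod_cast Nat.one_le_iff_ne_zero.mpr (NeZero.ne k)
  have hM' : (1 : ℝ) ≤ M := by exact_mod_cast hM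
  have hN' : (0 : ℝ) < S.card := by exact_mod_cast hN
  obtain ⟨E, hE⟩ : ∃ E, E = Real.exp 1 * (k * M / (ε * δ * γ)) * (1 + 1 / α) := ⟨_, rfl⟩
  rw [← hE] at hsize
  obtain ⟨hE1, hQE, hEsq⟩ := sample_parameter_bounds hk hM' hε hε1 hα hδ hδ1 hγ hγ1 hE
  have hE0 : 0 < E := (Real.exp_pos 1).trans_le hE1
  have hL1 : 1 ≤ Real.log E := (Real.le_log_iff_exp_le hE0).mpr hE1
  set Q : ℝ := M ^ 2 / (γ ^ 2 * ε * α) with hQ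
  have hQ0 : 0 ≤ Q := by positivity
  have hQN : 2000000 * Real.log E ^ 2 * Q ≤ S.card := by
    refine le_trans ?_ hsize
    refine mul_le_mul_of_nonneg_left ?_ (by positivity)
    have : (M : ℝ) ^ 3 / (ε ^ 2 * γ ^ 2 * α) = Q * (M / ε) := by rw [hQ]; field_simp
    rw [this]
    refine le_mul_of_one_le_right hQ0 ?_
    rw [one_le_div hε]
    linarith
  have hmain := mul_one_add_log_le_of_le hN' hQ0 hE1 hQE hQN
  have hΔ' : ∀ m, 0 ≤ Δ m ∧ m * Δ m ≤ 16 * (1 + Real.log m) := by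
    rcases hΔ with rfl | rfl
    · exact gainSensitivity_bounds h
    · exact gainSensitivityBound_bounds
  have hsize' : 100 * M * (128 * M * (4 * Real.log E) * (1 + Real.log S.card) / α)
      ≤ γ ^ 2 * (ε * S.card) := by
    have h1 := mul_le_mul_of_nonneg_left hmain (show 0 ≤ γ ^ 2 * ε by positivity)
    refine le_trans (le_of_eq ?_) (h1.trans (le_of_eq (by ring)))
    rw [hQ]
    field_simp
    ring
  have hsub : {ω : Tape k | ∃ t : ℕ, t ≤ M ∧
        (1 / ε) ^ (2000000 * Real.log (1 / ε) / γ ^ 2) ≤ (t : ℝ) ∧ ε < trainingError S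
          (topDownClassifier (rnmSplit h Δ) (fun _ => 1 / (M : ℝ)) h S M ε α δ ω t)}
      ⊆ {ω | ∃ c < 2 * M + 1, ∃ d, 4 * Real.log E < |ω (c, d)|} := by
    rintro ω ⟨t, htM, ht, herr⟩
    by_contra hω
    simp only [Set.mem_ofPred_eq, not_exists, not_and, not_lt] at hω
    exact absurd (trainingError_topDown_le (by norm_num) hw hγ hf hN hM hε hα
      (by linarith) hΔ' (fun c hc d => hω c hc d) hsize' htM ht) (not_le.mpr herr)
  refine (measure_mono hsub).trans ((tapeLaw_exists_large_le k (2 * M + 1) _).trans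
    (ENNReal.ofReal_le_ofReal ?_))
  have hexp : Real.exp (-(4 * Real.log E) / 2) = (E ^ 2)⁻¹ := by
    have : -(4 * Real.log E) / 2 = -Real.log (E ^ 2) := by
      rw [Real.log_pow]; push_cast; ring
    rw [this, Real.exp_neg, Real.exp_log (by positivity)]
  rw [hexp]
  have hcount : ((2 * M + 1 : ℕ) : ℝ) * (k + 3) ≤ 12 * (k * M) := by
    push_cast
    nlinarith
  calc ((2 * M + 1 : ℕ) : ℝ) * (k + 3) * (2 * (E ^ 2)⁻¹)
      ≤ 12 * (k * M) * (2 * (E ^ 2)⁻¹) := by gcongr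
    _ = δ * (24 * (k * M / δ)) * (E ^ 2)⁻¹ := by field_simp; norm_num
    _ ≤ δ * E ^ 2 * (E ^ 2)⁻¹ := by gcongr
    _ = δ := by field_simp
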